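/- Let $(\Omega,\mathcal F,P)$ be a complete probability space with a filtration $(\mathcal F_t)_{t=0}^T$ of complete sub-$\sigma$-algebras, and let $s=(s_t)_{t=0}^T$ be an $\mathbb R^d$-valued adapted price process, $\Delta s_{t+1}=s_{t+1}-s_t$. Let $\mathcal N$ be the set of processes $x=(x_t)_{t=0}^T$ with $x_t$ $\mathcal F_t$-measurable and $\mathbb R^d$-valued, and $\mathcal N^\infty\subset\mathcal N$ the essentially bounded ones. Let $\mathcal U,\mathcal Y\subset L^0(\Omega,\mathcal F,P;\mathbb R)$ be linear spaces which are decomposable (i.e. $1_Au+1_{\Omega\setminus A}u'$ belongs to the space whenever $A\in\mathcal F$, $u$ is in the space and $u'\in L^\infty$) and in separating duality under the (finite) bilinear form $\langle u,y\rangle=E(uy)$. The expectation of an extended real random variable is defined as $+\infty$ unless its positive part is integrable. Let $V:\mathbb R\times\Omega\to(-\infty,+\infty]$ be a convex normal integrand (jointly measurable, and convex, lower semicontinuous and proper in the first argument) such that, for every $\omega$, $V(\cdot,\omega)$ is nondecreasing and nonconstant and $V(0,\omega)=0$; let $V^*(\eta,\omega)=\sup_{\xi\in\mathbb R}\{\xi\eta-V(\xi,\omega)\}$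 and let $\partial V(\cdot,\omega)$ be the subdifferential of $V(\cdot,\omega)$. For $u\in\mathcal U$ consider the problem $$\text{minimize}\quad EV\Big(u-\sum_{t=0}^{T-1}x_t\cdot\Delta s_{t+1}\Big)\quad\text{over } x\in\mathcal N,\tag{ALM}$$ and let $\varphi(u)$ be its optimal value. An $x\in\mathcal N$ is feasible if the objective at $x$ is less than $+\infty$. Assume that - for every $x\in\mathcal N^\infty$ there is a $u\in\mathcal U$ with $EV(u-\sum_{t=0}^{T-1}x_t\cdot\Delta s_{t+1})<\infty$; - $\varphi$ is proper on $\mathcal U$ (never $-\infty$, and finite at some point); - $\mathcal U$ is barreled with respect to some locally convex topology under which the continuous linear functionals on $\mathcal U$ are exactly $u\mapsto\langle u,y\rangle$, $y\in\mathcal Y$; - $EV(u)$ is finite for every $u\in\mathcal U$, and $EV^*$ is proper on $\mathcal Y$. Let $\mathcal Q$ be the set of scaled martingale densities in $\mathcal Y$: it consists of $0$ and of all $y\in\mathcal Y$ of the form $y=c\,dQ/dP$ with $c>0$ and $Q\ll P$ a probability measure under which the normalized price process $(s_t-s_0)_{t=0}^T$ is a martingale (when $s_0$ is $Q$-integrable,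 this means that $s$ is a $Q$-martingale). Then, for every $u\in\mathcal U$, an $x\in\mathcal N$ solves (ALM) if and only if $x$ is feasible and there exists $y\in\mathcal Q$ such that $$y\in\partial V\Big(u-\sum_{t=0}^{T-1}x_t\cdot\Delta s_{t+1}\Big)\quad P\text{-a.s.}$$ -/

import Mathlib

open MeasureTheory ProbabilityTheory
open scoped ENNReal

namespace OptInv

noncomputable section

/-- Expectation of an extended real random variable `φ`, with the convention that it is `+∞`
unless the positive part of `φ` is integrable. -/
def expect {Ω : Type*} [MeasurableSpace Ω] (P : Measure Ω) (φ : Ω → EReal) : EReal :=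
  open Classical in
  if ∫⁻ ω, (φ ω).toENNReal ∂P = ⊤ then ⊤
  else ((∫⁻ ω, (φ ω).toENNReal ∂P : ℝ≥0∞) : EReal) - ((∫⁻ ω, (-φ ω).toENNReal ∂P : ℝ≥0∞) : EReal)

/-- A convex normal integrand on `ℝ × Ω` (for a complete probability space): a jointly measurable
function that is convex (has a convex epigraph), lower semicontinuous and proper in its first
argument. -/
structure IsConvexNormalIntegrand {Ω : Type*} [MeasurableSpace Ω] (V : ℝ → Ω → EReal) : Prop where
  measurable : Measurable fun p : ℝ × Ω => V p.1 p.2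
  convex : ∀ ω, Convex ℝ {p : ℝ × ℝ | V p.1 ω ≤ (p.2 : EReal)}
  lsc : ∀ ω, LowerSemicontinuous fun ξ => V ξ ω
  ne_bot : ∀ ω ξ, V ξ ω ≠ ⊥
  exists_ne_top : ∀ ω, ∃ ξ, V ξ ω ≠ ⊤

/-- A disutility integrand: a convex normal integrand `V` with `V(·, ω)` nondecreasing and
nonconstant, and `V(0, ω) = 0`. -/
structure IsDisutility {Ω : Type*} [MeasurableSpace Ω] (V : ℝ → Ω → EReal) : Prop extends
    IsConvexNormalIntegrand V where
  monotone : ∀ ω, Monotone fun ξ => V ξ ω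
  nonconstant : ∀ ω, ∃ ξ ξ', V ξ ω ≠ V ξ' ω
  map_zero : ∀ ω, V 0 ω = 0

/-- The conjugate integrand `V*(η, ω) = sup_ξ {ξ η - V(ξ, ω)}`. -/
def conj {Ω : Type*} (V : ℝ → Ω → EReal) (η : ℝ) (ω : Ω) : EReal :=
  ⨆ ξ : ℝ, (((ξ * η : ℝ) : EReal) - V ξ ω)

/-- The subdifferential `∂V(ξ, ω)` of `V(·, ω)` at `ξ`. -/
def subdiff {Ω : Type*} (V : ℝ → Ω → EReal) (ξ : ℝ) (ω : Ω) : Set ℝ :=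
  {η | ∀ ξ' : ℝ, V ξ ω + (((ξ' - ξ) * η : ℝ) : EReal) ≤ V ξ' ω}

/-- A linear space of random variables is decomposable if `1_A u + 1_{Aᶜ} u'` belongs to it
for all `A ∈ 𝓕`, all `u` in the space and all `u' ∈ L^∞`. -/
def Decomposable {Ω : Type*} [MeasurableSpace Ω] {P : Measure Ω}
    (U : Submodule ℝ (Ω →ₘ[P] ℝ)) : Prop :=
  ∀ A : Set Ω, MeasurableSet A → ∀ u ∈ U, ∀ u' : Ω →ₘ[P] ℝ, MemLp u' ⊤ P →
    ∀ w : Ω →ₘ[P] ℝ, (∀ᵐ ω ∂P, w ω = A.indicator u ω + Aᶜ.indicator u' ω) → w ∈ U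

/-- The bilinear form `⟨u, y⟩ = E(u y)`. -/
def pairing {Ω : Type*} [MeasurableSpace Ω] {P : Measure Ω} (u y : Ω →ₘ[P] ℝ) : ℝ :=
  ∫ ω, u ω * y ω ∂P

/-- `U` and `Y` are in separating duality under `⟨u, y⟩ = E(u y)`. -/
structure SeparatingDuality {Ω : Type*} [MeasurableSpace Ω] {P : Measure Ω}
    (U Y : Submodule ℝ (Ω →ₘ[P] ℝ)) : Prop where
  integrable : ∀ u ∈ U, ∀ y ∈ Y, Integrable (fun ω => u ω * y ω) P
  eq_zero_left : ∀ u ∈ U, (∀ y ∈ Y, pairing u y = 0) → u = 0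
  eq_zero_right : ∀ y ∈ Y, (∀ u ∈ U, pairing u y = 0) → y = 0

/-- `U` is barreled with respect to some locally convex vector space topology `τ` that is
compatible with the pairing with `Y`, i.e. the `τ`-continuous linear functionals on `U` are exactly
the functionals `u ↦ ⟨u, y⟩` with `y ∈ Y`. -/
def Barreled {Ω : Type*} [MeasurableSpace Ω] {P : Measure Ω}
    (U Y : Submodule ℝ (Ω →ₘ[P] ℝ)) : Prop :=
  ∃ τ : TopologicalSpace U,
    @IsTopologicalAddGroup U τ _ ∧ @ContinuousSMul ℝ U _ _ τ ∧
    @LocallyConvexSpace ℝ U _ _ _ _ τ ∧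
    (∀ ℓ : U →ₗ[ℝ] ℝ, @Continuous U ℝ τ _ ℓ ↔ ∃ y ∈ Y, ∀ u : U, ℓ u = pairing (u : Ω →ₘ[P] ℝ) y) ∧
    @BarrelledSpace ℝ U _ _ _ τ

/-- The space `𝓝` of adapted strategies `x = (x_0, …, x_T)`. -/
def strategies {Ω : Type*} [mΩ : MeasurableSpace Ω] {T : ℕ} (ℱ : Filtration (Fin (T + 1)) mΩ)
    (d : ℕ) : Set (Fin (T + 1) → Ω → EuclideanSpace ℝ (Fin d)) :=
  {x | ∀ t, Measurable[ℱ t] (x t)}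

/-- The space `𝓝^∞` of essentially bounded adapted strategies. -/
def boundedStrategies {Ω : Type*} [mΩ : MeasurableSpace Ω] (P : Measure Ω) {T : ℕ}
    (ℱ : Filtration (Fin (T + 1)) mΩ) (d : ℕ) :
    Set (Fin (T + 1) → Ω → EuclideanSpace ℝ (Fin d)) :=
  {x | x ∈ strategies ℱ d ∧ ∃ C : ℝ, ∀ t, ∀ᵐ ω ∂P, ‖x t ω‖ ≤ C}

/-- The net position `u - ∑_{t=0}^{T-1} x_t · Δs_{t+1}`. -/
def netPosition {Ω : Type*} {T d : ℕ} (s x : Fin (T + 1) → Ω → EuclideanSpace ℝ (Fin d))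
    (u : Ω → ℝ) (ω : Ω) : ℝ :=
  u ω - ∑ t : Fin T, inner ℝ (x t.castSucc ω) (s t.succ ω - s t.castSucc ω)

/-- The objective `E V(u - ∑_{t=0}^{T-1} x_t · Δs_{t+1})`. -/
def objective {Ω : Type*} [MeasurableSpace Ω] (P : Measure Ω) {T d : ℕ}
    (s : Fin (T + 1) → Ω → EuclideanSpace ℝ (Fin d)) (V : ℝ → Ω → EReal)
    (x : Fin (T + 1) → Ω → EuclideanSpace ℝ (Fin d)) (u : Ω → ℝ) : EReal :=
  expect P fun ω => V (netPosition s x u ω) ω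

/-- The optimal value `φ(u)`. -/
def valueFunction {Ω : Type*} [mΩ : MeasurableSpace Ω] (P : Measure Ω) {T d : ℕ}
    (ℱ : Filtration (Fin (T + 1)) mΩ) (s : Fin (T + 1) → Ω → EuclideanSpace ℝ (Fin d))
    (V : ℝ → Ω → EReal) (u : Ω → ℝ) : EReal :=
  ⨅ x ∈ strategies ℱ d, objective P s V x u

/-- An extended real function `g` is proper on `S`: never `-∞` there, and finite at some point. -/
def ProperOn {α : Type*} (S : Set α) (g : α → EReal) : Prop :=
  (∀ a ∈ S, g a ≠ ⊥) ∧ ∃ a ∈ S, g a ≠ ⊤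

/-- The scaled martingale densities in `Y`: the multiples `c • dQ/dP`, `c > 0`, of densities of
probability measures `Q ≪ P` under which the price process, normalized to start at the origin,
is a martingale, together with `0`. If `s 0` is `Q`-integrable, the normalization is immaterial
(see `martingale_sub_initial_iff`). -/
def scaledMartingaleDensities {Ω : Type*} [mΩ : MeasurableSpace Ω] {P : Measure Ω} {T d : ℕ}
    (ℱ : Filtration (Fin (T + 1)) mΩ) (s : Fin (T + 1) → Ω → EuclideanSpace ℝ (Fin d))
    (Y : Submodule ℝ (Ω →ₘ[P] ℝ)) : Set (Ω →ₘ[P] ℝ) :=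
  {y | y ∈ Y ∧ (y = 0 ∨ ∃ Q : Measure Ω, IsProbabilityMeasure Q ∧ Q ≪ P ∧
    Martingale (fun t ω => s t ω - s 0 ω) ℱ Q ∧
    ∃ c : ℝ, 0 < c ∧ ∀ᵐ ω ∂P, y ω = c * (Q.rnDeriv P ω).toReal)}

theorem martingale_sub_initial_iff {Ω : Type*} [mΩ : MeasurableSpace Ω] {T d : ℕ}
    (ℱ : Filtration (Fin (T + 1)) mΩ) (s : Fin (T + 1) → Ω → EuclideanSpace ℝ (Fin d))
    (Q : Measure Ω) [IsProbabilityMeasure Q] (hs : Measurable[ℱ 0] (s 0))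
    (hint : Integrable (s 0) Q) :
    Martingale (fun t ω => s t ω - s 0 ω) ℱ Q ↔ Martingale s ℱ Q := by
  have h0 : Martingale (fun _ : Fin (T + 1) => s 0) ℱ Q :=
    martingale_const_fun ℱ Q (StronglyMeasurable.mono hs.stronglyMeasurable (ℱ.mono (Fin.zero_le _))) hint
  constructor
  · intro h
    have := h.add h0
    convert this using 1
    ext t ω
    simp
  · intro h
    exact h.sub h0

end

end OptInv

/-! The value function `φ` is convex, and the zero strategy gives `φ ≤ EV` on `U`. Since `EV` is
finite on `U` and `U` contains the constants, `V` may be replaced by a real-valued integrand `v`.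
Finiteness of `EV*` at one point of `Y` makes `EV` a supremum of continuous affine functions, so its
sublevel sets are closed. Barrelledness then bounds `EV`, hence `φ`, near the origin, and `φ` has a
continuous subgradient at every `u`, represented by some `y ∈ Y`
(`exists_subgradient_valueFunction`).

The subgradient inequality bounds `⟨u', y⟩ - EV(u' - gains of x')` by `K = ⟨u, y⟩ - φ(u)` for all
`u'` and `x'`. Optimizing over `u'` under the expectation (`integral_max_le`) yields `EV*(y) ≤ K`
when `x' = 0`. For multiples `c` of an elementary strategy it yields `c · E(gain · y) ≤ K` for every
real `c`, so the mean is zero and `y` is a scaled martingale density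
(`conj_le_and_mem_scaledMartingaleDensities`).

Strategies are unbounded, so gains need not be integrable a priori. They are generalized martingale
transforms, and integrability of the negative part alone forces integrability and zero mean
(`integral_gains_mul_eq_zero`). With this, at an optimal `x` the Fenchel inequality between `u -
gains` and `y` has a nonnegative gap of zero mean, hence equality holds almost surely, which is the
subgradient condition. Conversely, integrating the subgradient inequality against any other strategy
makes the gains term drop out, which proves optimality. -/

namespace OptInv

/-! ### Subgradients of finite convex functions, algebraic and on barrelled spaces. -/

section Subgradient

open scoped Pointwise

variable {E : Type*} [AddCommGroup E] [Module ℝ E]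

/-- The directional derivative at the origin of a convex function vanishing there. -/
noncomputable def dirDeriv (F : E → ℝ) (h : E) : ℝ :=
  ⨅ t : Set.Ioi (0 : ℝ), F ((t : ℝ) • h) / t

/-- The origin is a convex combination of `t • h` and `-h`. This lower bound on the difference
quotients keeps the real infimum in `dirDeriv` from taking its default value for unbounded sets. -/
theorem neg_le_div_of_convexOn {F : E → ℝ} (hF : ConvexOn ℝ Set.univ F) (h0 : F 0 = 0) (h : E)
    {t : ℝ} (ht : 0 < t) : -F (-h) ≤ F (t • h) / t := by
  have h1t : (0 : ℝ) < 1 + t := by linarith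
  have key := hF.2 (Set.mem_univ (t • h)) (Set.mem_univ (-h))
    (show 0 ≤ 1 / (1 + t) by positivity) (show 0 ≤ t / (1 + t) by positivity) (by field_simp)
  have hz : (1 / (1 + t)) • t • h + (t / (1 + t)) • (-h) = 0 := by
    rw [smul_smul, smul_neg, one_div_mul_eq_div, add_neg_cancel]
  rw [hz, h0, smul_eq_mul, smul_eq_mul] at key
  rw [le_div_iff₀ ht]
  have : 0 ≤ (F (t • h) + t * F (-h)) / (1 + t) := by
    calc 0 ≤ _ := key
      _ = _ := by ring
  have := mul_nonneg this h1t.le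
  rw [div_mul_cancel₀ _ h1t.ne'] at this
  linarith

theorem dirDeriv_le {F : E → ℝ} (hF : ConvexOn ℝ Set.univ F) (h0 : F 0 = 0) (h : E)
    {t : ℝ} (ht : 0 < t) : dirDeriv F h ≤ F (t • h) / t :=
  ciInf_le ⟨-F (-h), by rintro _ ⟨⟨t, ht⟩, rfl⟩; exact neg_le_div_of_convexOn hF h0 h ht⟩
    (⟨t, ht⟩ : Set.Ioi (0 : ℝ))

theorem dirDeriv_smul (F : E → ℝ) {c : ℝ} (hc : 0 < c) (h : E) :
    dirDeriv F (c • h) = c * dirDeriv F h := by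
  unfold dirDeriv
  rw [Real.mul_iInf_of_nonneg hc.le]
  let e : Set.Ioi (0 : ℝ) ≃ Set.Ioi (0 : ℝ) :=
    { toFun := fun t => ⟨t * c, mul_pos t.2 hc⟩
      invFun := fun t => ⟨t / c, div_pos t.2 hc⟩
      left_inv := fun t => by ext; simp [hc.ne']
      right_inv := fun t => by ext; simp [hc.ne'] }
  refine Equiv.iInf_congr e fun t => ?_
  have ht : (0 : ℝ) < t := t.2
  simp only [e, Equiv.coe_fn_mk, smul_smul]
  field_simp

/-- Quotients with step sizes `t₁` and `t₂` combine by convexity at the step `t₁ t₂ / (t₁ + t₂)`,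
chosen so that both vectors get the same coefficient. -/
theorem dirDeriv_add_le {F : E → ℝ} (hF : ConvexOn ℝ Set.univ F) (h0 : F 0 = 0) (a b : E) :
    dirDeriv F (a + b) ≤ dirDeriv F a + dirDeriv F b := by
  have : Nonempty (Set.Ioi (0 : ℝ)) := ⟨⟨1, Set.mem_Ioi.2 one_pos⟩⟩
  refine le_ciInf_add_ciInf ?_
  rintro ⟨t₁, ht₁⟩ ⟨t₂, ht₂⟩
  simp only [Set.mem_Ioi] at ht₁ ht₂
  have hpos : 0 < t₁ + t₂ := by positivity
  have key := hF.2 (Set.mem_univ (t₁ • a)) (Set.mem_univ (t₂ • b))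
    (show 0 ≤ t₂ / (t₁ + t₂) by positivity) (show 0 ≤ t₁ / (t₁ + t₂) by positivity)
    (by field_simp; ring)
  have ht : 0 < t₁ * t₂ / (t₁ + t₂) := by positivity
  refine (dirDeriv_le hF h0 (a + b) ht).trans ?_
  have hz : (t₁ * t₂ / (t₁ + t₂)) • (a + b) =
      (t₂ / (t₁ + t₂)) • t₁ • a + (t₁ / (t₁ + t₂)) • t₂ • b := by
    rw [smul_smul, smul_smul, smul_add]
    congr 2 <;> ring
  rw [hz, div_le_iff₀ ht]
  refine key.trans (le_of_eq ?_)
  simp only [smul_eq_mul]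
  field_simp

/-- A finite convex function on a real vector space has an algebraic subgradient at every point. -/
theorem exists_algebraic_subgradient {f : E → ℝ} (hf : ConvexOn ℝ Set.univ f) (x₀ : E) :
    ∃ ℓ : E →ₗ[ℝ] ℝ, ∀ x, f x₀ + ℓ (x - x₀) ≤ f x := by
  set F : E → ℝ := fun h => f (x₀ + h) - f x₀ with hFdef
  have hF : ConvexOn ℝ Set.univ F := by
    have h1 := hf.translate_right x₀
    simp only [Set.preimage_univ] at h1
    exact (h1.add_const (-f x₀)).congr fun _ _ => (sub_eq_add_neg _ _).symm
  have h0 : F 0 = 0 := by simp [hFdef]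
  -- Hahn–Banach, extending the zero functional from the zero subspace under the sublinear bound
  -- `dirDeriv F`.
  obtain ⟨ℓ, -, hℓ⟩ := exists_extension_of_le_sublinear (⟨⊥, 0⟩ : E →ₗ.[ℝ] ℝ) (dirDeriv F)
    (fun c hc x => dirDeriv_smul F hc x) (dirDeriv_add_le hF h0) (by
      rintro ⟨x, hx⟩
      have hx0 : x = 0 := (Submodule.mem_bot ℝ).1 hx
      subst hx0
      have : (0 : ℝ) ≤ dirDeriv F 0 := by
        have : Nonempty (Set.Ioi (0 : ℝ)) := ⟨⟨1, Set.mem_Ioi.2 one_pos⟩⟩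
        exact le_ciInf fun t => by simp [h0]
      exact this)
  refine ⟨ℓ, fun x => ?_⟩
  have := (hℓ (x - x₀)).trans (dirDeriv_le hF h0 (x - x₀) one_pos)
  simp only [hFdef, one_smul, div_one, add_sub_cancel] at this
  linarith

variable [TopologicalSpace E] [IsTopologicalAddGroup E] [ContinuousSMul ℝ E] [BarrelledSpace ℝ E]

/-- On a barrelled space, a finite convex function with closed sublevel sets that vanishes at the
origin is at most one on the open unit ball of a continuous seminorm. -/
theorem exists_continuous_seminorm_of_closed_sublevel {g : E → ℝ} (hg : ConvexOn ℝ Set.univ g)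
    (h0 : g 0 = 0) (hcl : IsClosed {x | g x ≤ 1}) :
    ∃ p : Seminorm ℝ E, Continuous p ∧ ∀ x, p x < 1 → g x ≤ 1 := by
  -- Symmetrizing the sublevel set makes it a barrel: closed, convex, balanced and absorbent. Its
  -- gauge is the required seminorm.
  set B : Set E := {x | g x ≤ 1} ∩ {x | g (-x) ≤ 1} with hB
  have hclB : IsClosed B := hcl.inter (hcl.preimage continuous_neg)
  have hconv1 : Convex ℝ {x | g x ≤ 1} := by simpa using hg.convex_le 1
  have hconv : Convex ℝ B := hconv1.inter hconv1.neg
  have hzero : (0 : E) ∈ B := by simp [hB, h0]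
  have hneg : ∀ x ∈ B, -x ∈ B := fun x hx => ⟨hx.2, by simpa using hx.1⟩
  have hscale : ∀ x, ∀ t : ℝ, 0 ≤ t → t ≤ 1 → g (t • x) ≤ t * g x := fun x t ht0 ht1 => by
    have := hg.2 (Set.mem_univ x) (Set.mem_univ 0) ht0 (sub_nonneg.2 ht1) (by ring)
    simpa [h0] using this
  have hstar : ∀ x ∈ B, ∀ t : ℝ, 0 ≤ t → t ≤ 1 → t • x ∈ B := fun x hx t h0 h1 =>
    hconv.smul_mem_of_zero_mem hzero hx ⟨h0, h1⟩
  have hbal : Balanced ℝ B := by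
    refine balanced_iff_smul_mem.2 fun a ha x hx => ?_
    rw [Real.norm_eq_abs, abs_le] at ha
    rcases le_total 0 a with h | h
    · exact hstar x hx a h ha.2
    · have := hstar _ (hneg x hx) (-a) (by linarith) (by linarith)
      simpa using this
  have habs : Absorbent ℝ B := by
    intro x
    refine Absorbs.of_norm ⟨max 1 (max (g x) (g (-x))), fun c hc => ?_⟩
    have hcpos : 0 < ‖c‖ := lt_of_lt_of_le one_pos ((le_max_left _ _).trans hc)
    have hc0 : c ≠ 0 := norm_pos_iff.1 hcpos
    have hmem : ‖c‖⁻¹ • x ∈ B := by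
      have hle1 : ‖c‖⁻¹ ≤ 1 := inv_le_one_of_one_le₀ ((le_max_left _ _).trans hc)
      have hb : ∀ z, g z ≤ ‖c‖ → g (‖c‖⁻¹ • z) ≤ 1 := fun z hz =>
        (hscale z _ (by positivity) hle1).trans (by
          rw [inv_mul_le_iff₀ hcpos, mul_one]; exact hz)
      refine ⟨hb x (le_trans (by simp) hc), ?_⟩
      have := hb (-x) (le_trans (by simp) hc)
      simpa using this
    rw [Set.singleton_subset_iff, Set.mem_smul_set_iff_inv_smul_mem₀ hc0]
    rcases le_total 0 c with h | h
    · rwa [Real.norm_of_nonneg h] at hmem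
    · rw [Real.norm_of_nonpos h] at hmem
      have := hneg _ hmem
      simpa [inv_neg] using this
  have hmem : ∀ x, ∀ r : ℝ, 0 < r → gauge B x < r → x ∈ r • B := fun x r hr hx => by
    obtain ⟨b, hb0, hbr, hxb⟩ := exists_lt_of_gauge_lt habs hx
    rw [Set.mem_smul_set_iff_inv_smul_mem₀ hb0.ne'] at hxb
    rw [Set.mem_smul_set_iff_inv_smul_mem₀ hr.ne']
    have := hstar _ hxb (b / r) (by positivity) ((div_le_one hr).2 hbr.le)
    rw [smul_smul] at this
    convert this using 2
    field_simp
  refine ⟨gaugeSeminorm hbal hconv habs, ?_, fun x hx => ?_⟩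
  -- Barrelledness enters here: a lower semicontinuous seminorm is continuous. The sublevel set of
  -- the gauge at `a ≥ 0` is the intersection of the closed dilates `r • B` with `r > a`.
  · refine Seminorm.continuous_of_lowerSemicontinuous _
      (lowerSemicontinuous_iff_isClosed_preimage.2 fun a => ?_)
    rcases lt_or_ge a 0 with ha | ha
    · convert isClosed_empty
      ext x
      simp only [Set.mem_preimage, Set.mem_Iic, Set.mem_empty_iff_false, iff_false, not_le]
      exact ha.trans_le (apply_nonneg _ _)
    · have : (gaugeSeminorm hbal hconv habs) ⁻¹' Set.Iic a = ⋂ r : Set.Ioi a, (r : ℝ) • B := by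
        ext x
        simp only [Set.mem_preimage, Set.mem_Iic, Set.mem_iInter, Subtype.forall, Set.mem_Ioi]
        constructor
        · intro h r hr
          exact hmem x r (ha.trans_lt hr) (lt_of_le_of_lt h hr)
        · intro h
          refine le_of_forall_gt_imp_ge_of_dense fun r hr => ?_
          exact gauge_le_of_mem (ha.trans hr.le) (h r hr)
      rw [this]
      exact isClosed_iInter fun r => hclB.smul_of_ne_zero (ha.trans_lt r.2).ne'
  · have := hmem x 1 one_pos hx
    rw [one_smul] at this
    exact this.1

/-- On a barrelled space, a finite convex function dominated by a finite convex function with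
closed sublevel sets has a continuous subgradient at every point. -/
theorem exists_continuous_subgradient {f g : E → ℝ} (hf : ConvexOn ℝ Set.univ f)
    (hg : ConvexOn ℝ Set.univ g) (hfg : ∀ x, f x ≤ g x) (h0 : g 0 = 0)
    (hcl : IsClosed {x | g x ≤ 1}) (x₀ : E) :
    ∃ ℓ : E →ₗ[ℝ] ℝ, Continuous ℓ ∧ ∀ x, f x₀ + ℓ (x - x₀) ≤ f x := by
  obtain ⟨ℓ, hℓ⟩ := exists_algebraic_subgradient hf x₀
  obtain ⟨p, hp, hpg⟩ := exists_continuous_seminorm_of_closed_sublevel hg h0 hcl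
  refine ⟨ℓ, ?_, hℓ⟩
  -- The bound comes from `x₀ + h` being the midpoint of `2 x₀` and `2 h`, together with `f (2 h) ≤
  -- g (2 h) ≤ 1` when `p h < 1 / 2`.
  set C : ℝ := |f ((2 : ℝ) • x₀)| / 2 + 1 / 2 + |f x₀| + 1 with hC
  have hCpos : 0 < C := by positivity
  have hbound : ∀ h, p h < 1 / 2 → ℓ h ≤ C := fun h hh => by
    have h1 := hℓ (x₀ + h)
    have h2 := hf.2 (Set.mem_univ ((2 : ℝ) • x₀)) (Set.mem_univ ((2 : ℝ) • h))
      (show (0 : ℝ) ≤ 1 / 2 by norm_num) (show (0 : ℝ) ≤ 1 / 2 by norm_num) (by norm_num)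
    have h3 : g ((2 : ℝ) • h) ≤ 1 := hpg _ (by
      rw [map_smul_eq_mul]; norm_num; linarith)
    have h4 := hfg ((2 : ℝ) • h)
    rw [smul_smul, smul_smul] at h2
    norm_num at h2 h1
    have := le_abs_self (f ((2 : ℝ) • x₀))
    have := neg_abs_le (f x₀)
    linarith
  have habs : ∀ h, p h < 1 / 2 → |ℓ h| ≤ C := fun h hh => abs_le.2
    ⟨by have := hbound (-h) (by simpa using hh); rw [map_neg] at this; linarith, hbound h hh⟩
  refine continuous_of_continuousAt_zero ℓ ?_
  rw [ContinuousAt, map_zero, Metric.tendsto_nhds]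
  intro ε hε
  -- The factor 2 leads to `|ℓ h| ≤ ε / 2`, which is strictly below `ε`.
  have hev : ∀ᶠ h in nhds (0 : E), p ((2 * C / ε) • h) < 1 / 2 := by
    have hc : Continuous fun h : E => p ((2 * C / ε) • h) := hp.comp (continuous_const_smul _)
    exact hc.continuousAt.eventually_lt continuousAt_const (by simp)
  filter_upwards [hev] with h hh
  have := habs _ hh
  rw [map_smul, smul_eq_mul, abs_mul, abs_of_pos (by positivity)] at this
  rw [dist_zero_right, Real.norm_eq_abs]
  have h5 : 2 * |ℓ h| ≤ ε := by
    have h6 : 2 * C / ε * |ℓ h| = (2 * |ℓ h| / ε) * C := by ring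
    rw [h6] at this
    have := (mul_le_iff_le_one_left hCpos).1 this
    rwa [div_le_one hε] at this
  rcases eq_or_lt_of_le (abs_nonneg (ℓ h)) with h7 | h7
  · rw [← h7]; exact hε
  · linarith

end Subgradient

/-! ### Generalized martingale transforms with integrable negative part. -/

section MartingaleTransform

open Filter

variable {Ω : Type*}

/-- `W` is conditionally centered given `m` in the generalized sense: it is integrable with zero
conditional mean on each of a sequence of `m`-measurable sets exhausting `Ω`. -/
def CondCentered (m : MeasurableSpace Ω) {mΩ : MeasurableSpace Ω} (Q : Measure Ω) (W : Ω → ℝ) : Prop :=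
  ∃ A : ℕ → Set Ω, AECover Q atTop A ∧ (∀ n, MeasurableSet[m] (A n)) ∧
    (∀ n, IntegrableOn W (A n) Q) ∧
    ∀ n B, MeasurableSet[m] B → B ⊆ A n → ∫ ω in B, W ω ∂Q = 0

/-- Truncation at level `n` of a real function gives an exhausting sequence of sets. -/
theorem aecover_norm_le {mΩ : MeasurableSpace Ω} {E : Type*} [NormedAddCommGroup E] [MeasurableSpace E]
    [OpensMeasurableSpace E] {f : Ω → E} (Q : Measure Ω) (hf : Measurable f) :
    AECover Q atTop fun n : ℕ => {ω | ‖f ω‖ ≤ n} where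
  ae_eventually_mem := ae_of_all _ fun ω => by
    filter_upwards [eventually_ge_atTop ⌈‖f ω‖⌉₊] with n hn
    exact (Nat.le_ceil _).trans (Nat.cast_le.2 hn)
  measurableSet n := measurableSet_le hf.norm measurable_const

theorem integrableOn_norm_le {mΩ : MeasurableSpace Ω} {E : Type*} [NormedAddCommGroup E] [MeasurableSpace E]
    [BorelSpace E] [SecondCountableTopology E] {f : Ω → E} {Q : Measure Ω} [IsFiniteMeasure Q]
    (hf : Measurable f) (c : ℝ) {B : Set Ω} (hB : MeasurableSet B) (hBc : ∀ ω ∈ B, ‖f ω‖ ≤ c) :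
    IntegrableOn f B Q :=
  Measure.integrableOn_of_bounded (measure_ne_top _ _) hf.aestronglyMeasurable (M := c)
    ((ae_restrict_iff' hB).2 (ae_of_all _ hBc))

/-- A conditionally centered increment does not decrease the mean negative part. -/
theorem CondCentered.integrable_negPart_left {m mΩ : MeasurableSpace Ω} (hm : m ≤ mΩ) {Q : Measure Ω}
    [IsFiniteMeasure Q] {ξ W : Ω → ℝ} (hξ : Measurable[m] ξ) (hW : CondCentered m Q W)
    (hneg : Integrable (fun ω => max (-(ξ ω + W ω)) 0) Q) :
    Integrable (fun ω => max (-ξ ω) 0) Q := by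
  obtain ⟨A, hA, hAm, hAi, hAz⟩ := hW
  have hξ' : Measurable ξ := hξ.mono hm le_rfl
  -- Truncating at `‖ξ‖ ≤ n` makes `ξ` integrable on each set, although no moment of `ξ` is assumed.
  have hC := (aecover_norm_le Q hξ').inter hA
  have hCm : ∀ n : ℕ, MeasurableSet[m] ({ω | ‖ξ ω‖ ≤ n} ∩ A n) := fun n =>
    (hξ (measurableSet_le measurable_norm measurable_const)).inter (hAm n)
  have hint : ∀ n : ℕ, IntegrableOn (fun ω => max (-ξ ω) 0) ({ω | ‖ξ ω‖ ≤ n} ∩ A n) Q := fun n =>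
    (integrableOn_norm_le hξ' n (hm _ (hCm n)) fun ω hω => hω.1).neg.pos_part
  refine hC.integrable_of_integral_bounded_of_nonneg_ae (∫ ω, max (-(ξ ω + W ω)) 0 ∂Q) hint
    (ae_of_all _ fun ω => le_max_right _ _) (Eventually.of_forall fun n => ?_)
  set C := {ω | ‖ξ ω‖ ≤ n} ∩ A n with hCdef
  have hB : MeasurableSet[m] (C ∩ {ω | ξ ω < 0}) :=
    (hCm n).inter (hξ measurableSet_Iio)
  have hBn : C ∩ {ω | ξ ω < 0} ⊆ A n := fun ω hω => hω.1.2
  have hξB : IntegrableOn ξ (C ∩ {ω | ξ ω < 0}) Q :=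
    integrableOn_norm_le hξ' n (hm _ hB) fun ω hω => hω.1.1
  calc ∫ ω in C, max (-ξ ω) 0 ∂Q
      = ∫ ω in C, {ω | ξ ω < 0}.indicator (fun ω => -ξ ω) ω ∂Q := by
        congr with ω
        by_cases h : ξ ω < 0
        · rw [Set.indicator_of_mem (by exact h), max_eq_left (by linarith)]
        · rw [Set.indicator_of_notMem (by exact h), max_eq_right (by linarith)]
    _ = ∫ ω in C ∩ {ω | ξ ω < 0}, -ξ ω ∂Q :=
        setIntegral_indicator (measurableSet_lt hξ' measurable_const)
    -- The set of integration is `m`-measurable and contained in `A n`, so `W` integrates to zero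
    -- over it.
    _ = ∫ ω in C ∩ {ω | ξ ω < 0}, -(ξ ω + W ω) ∂Q := by
        rw [integral_neg, integral_neg, integral_add hξB ((hAi n).mono_set hBn),
          hAz n _ hB hBn, add_zero]
    _ ≤ ∫ ω in C ∩ {ω | ξ ω < 0}, max (-(ξ ω + W ω)) 0 ∂Q :=
        integral_mono (hξB.add ((hAi n).mono_set hBn)).neg hneg.integrableOn
          fun ω => le_max_left _ _
    _ ≤ ∫ ω, max (-(ξ ω + W ω)) 0 ∂Q :=
        setIntegral_le_integral hneg (ae_of_all _ fun ω => le_max_right _ _)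

/-- If the negative part of `ξ + W` is integrable, `W` being conditionally centered and `ξ`
integrable, then `ξ + W` is integrable and has the same mean as `ξ`. -/
theorem CondCentered.integrable_add {m mΩ : MeasurableSpace Ω} {Q : Measure Ω}
    {ξ W : Ω → ℝ} (hξ : Integrable ξ Q) (hW : CondCentered m Q W)
    (hneg : Integrable (fun ω => max (-(ξ ω + W ω)) 0) Q) :
    Integrable (fun ω => ξ ω + W ω) Q ∧ ∫ ω, ξ ω + W ω ∂Q = ∫ ω, ξ ω ∂Q := by
  obtain ⟨A, hA, hAm, hAi, hAz⟩ := hW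
  have hi : ∀ n, IntegrableOn (fun ω => ξ ω + W ω) (A n) Q := fun n =>
    hξ.integrableOn.add (hAi n)
  have hz : ∀ n, ∫ ω in A n, ξ ω + W ω ∂Q = ∫ ω in A n, ξ ω ∂Q := fun n => by
    rw [integral_add hξ.integrableOn (hAi n), hAz n _ (hAm n) subset_rfl, add_zero]
  have hint : Integrable (fun ω => ξ ω + W ω) Q := by
    refine hA.integrable_of_integral_norm_bounded
      (∫ ω, ‖ξ ω‖ ∂Q + 2 * ∫ ω, max (-(ξ ω + W ω)) 0 ∂Q) hi (Eventually.of_forall fun n => ?_)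
    calc ∫ ω in A n, ‖ξ ω + W ω‖ ∂Q
        = ∫ ω in A n, (ξ ω + W ω) + 2 * max (-(ξ ω + W ω)) 0 ∂Q := by
          congr with ω
          rw [Real.norm_eq_abs]
          rcases le_total 0 (ξ ω + W ω) with h | h
          · rw [abs_of_nonneg h, max_eq_right (by linarith)]; ring
          · rw [abs_of_nonpos h, max_eq_left (by linarith)]; ring
      _ = ∫ ω in A n, ξ ω ∂Q + 2 * ∫ ω in A n, max (-(ξ ω + W ω)) 0 ∂Q := by
          rw [integral_add (hi n) (hneg.integrableOn.const_mul 2), hz n, integral_const_mul]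
      _ ≤ _ := by
          have h1 : ∫ ω in A n, ξ ω ∂Q ≤ ∫ ω, ‖ξ ω‖ ∂Q :=
            (integral_mono hξ.integrableOn hξ.norm.integrableOn
              fun ω => Real.le_norm_self _).trans
              (setIntegral_le_integral hξ.norm (ae_of_all _ fun ω => norm_nonneg _))
          have h2 := setIntegral_le_integral (s := A n) hneg (ae_of_all _ fun ω => le_max_right _ _)
          linarith
  refine ⟨hint, tendsto_nhds_unique (hA.integral_tendsto_of_countably_generated hint) ?_⟩
  simp_rw [hz]
  exact hA.integral_tendsto_of_countably_generated hξ

/-- A finite sum of generalized martingale differences whose negative part is integrable is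
integrable and centered. -/
theorem integrable_sum_of_integrable_negPart {mΩ : MeasurableSpace Ω} {Q : Measure Ω} [IsFiniteMeasure Q] :
    ∀ (n : ℕ) (𝒢 : Fin n → MeasurableSpace Ω) (W : Fin n → Ω → ℝ), (∀ i, 𝒢 i ≤ mΩ) →
      (∀ i j, i < j → Measurable[𝒢 j] (W i)) → (∀ i, CondCentered (𝒢 i) Q (W i)) →
      Integrable (fun ω => max (-∑ i, W i ω) 0) Q →
      Integrable (fun ω => ∑ i, W i ω) Q ∧ ∫ ω, ∑ i, W i ω ∂Q = 0 := by
  intro n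
  induction n with
  | zero => intro 𝒢 W _ _ _ _; simp
  | succ n ih =>
    intro 𝒢 W h𝒢 hW hc hneg
    simp_rw [Fin.sum_univ_castSucc] at hneg ⊢
    have hξ : Measurable[𝒢 (Fin.last n)] fun ω => ∑ i : Fin n, W i.castSucc ω :=
      Finset.measurable_fun_sum _ fun i _ => hW _ _ (Fin.castSucc_lt_last i)
    -- Integrability of the negative part passes down to the shorter sum. Integrability and zero
    -- mean then pass back up through the last increment.
    have h1 := (hc (Fin.last n)).integrable_negPart_left (h𝒢 _) hξ hneg
    obtain ⟨h2, h3⟩ := ih (fun i => 𝒢 i.castSucc) (fun i => W i.castSucc) (fun i => h𝒢 _)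
      (fun i j hij => hW _ _ (Fin.castSucc_lt_castSucc_iff.2 hij)) (fun i => hc _) h1
    obtain ⟨h4, h5⟩ := (hc (Fin.last n)).integrable_add h2 hneg
    exact ⟨h4, h5.trans h3⟩

/-- The inner product of a measurable random vector with an integrable random vector of vanishing
conditional expectation is conditionally centered. -/
theorem condCentered_inner {d : ℕ} {m mΩ : MeasurableSpace Ω} (hm : m ≤ mΩ) {Q : Measure Ω}
    [IsFiniteMeasure Q] {x Δ : Ω → EuclideanSpace ℝ (Fin d)} (hx : Measurable[m] x)
    (hΔ : Integrable Δ Q) (hΔm : Q[Δ | m] =ᵐ[Q] 0) :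
    CondCentered m Q fun ω => inner ℝ (x ω) (Δ ω) := by
  have hx' : Measurable x := hx.mono hm le_rfl
  have key : ∀ (n : ℕ) (B : Set Ω), MeasurableSet[m] B → (∀ ω ∈ B, ‖x ω‖ ≤ n) →
      IntegrableOn (fun ω => inner ℝ (x ω) (Δ ω)) B Q ∧
        ∫ ω in B, inner ℝ (x ω) (Δ ω) ∂Q = 0 := by
    intro n B hB hBn
    have hxB : StronglyMeasurable[m] (B.indicator x) := (hx.indicator hB).stronglyMeasurable
    have heq : (fun ω => inner ℝ (B.indicator x ω) (Δ ω)) =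
        B.indicator fun ω => inner ℝ (x ω) (Δ ω) := by
      ext ω
      by_cases h : ω ∈ B <;> simp [h]
    have hint : Integrable (fun ω => inner ℝ (B.indicator x ω) (Δ ω)) Q := by
      refine (hΔ.norm.const_mul n).mono'
        ((hxB.mono hm).aestronglyMeasurable.inner hΔ.aestronglyMeasurable)
        (ae_of_all _ fun ω => (norm_inner_le_norm _ _).trans ?_)
      refine mul_le_mul_of_nonneg_right ?_ (norm_nonneg _)
      by_cases h : ω ∈ B <;> simp [h, hBn]
    -- The truncated `x` is bounded and `m`-measurable, so it can be pulled out of the conditional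
    -- expectation of `Δ`.
    have hpull := condExp_bilin_of_stronglyMeasurable_left (μ := Q)
      (innerSL ℝ (E := EuclideanSpace ℝ (Fin d))) hxB hint hΔ
    refine ⟨(integrable_indicator_iff (hm _ hB)).1 (heq ▸ hint), ?_⟩
    rw [← integral_indicator (hm _ hB), ← heq, ← integral_condExp hm]
    refine integral_eq_zero_of_ae ?_
    filter_upwards [hpull, hΔm] with ω h1 h2
    exact h1.trans (by rw [h2]; simp)
  have hAm : ∀ n : ℕ, MeasurableSet[m] {ω | ‖x ω‖ ≤ n} := fun n =>
    hx (measurableSet_le measurable_norm measurable_const)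
  exact ⟨fun n => {ω | ‖x ω‖ ≤ n}, aecover_norm_le Q hx', hAm,
    fun n => (key n _ (hAm n) fun ω hω => hω).1, fun n B hB hBn => (key n B hB fun ω hω => hBn hω).2⟩

end MartingaleTransform

/-! ### Gains under martingale measures and recognition of martingale densities. -/

section MartingaleDensities

open Filter

variable {Ω : Type*} {mΩ : MeasurableSpace Ω} {P : Measure Ω} {T d : ℕ}
  {ℱ : Filtration (Fin (T + 1)) mΩ} {s x : Fin (T + 1) → Ω → EuclideanSpace ℝ (Fin d)}

/-- The terminal gains `∑ x_t · Δs_{t+1}` of a self-financing strategy. -/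
noncomputable def gains (s x : Fin (T + 1) → Ω → EuclideanSpace ℝ (Fin d)) (ω : Ω) : ℝ :=
  ∑ t : Fin T, inner ℝ (x t.castSucc ω) (s t.succ ω - s t.castSucc ω)

theorem measurable_gains (hs : ∀ t, Measurable[ℱ t] (s t)) (hx : x ∈ strategies ℱ d) :
    Measurable (gains s x) :=
  Finset.measurable_fun_sum _ fun t _ =>
    ((hx t.castSucc).mono (ℱ.le _) le_rfl).inner
      (((hs t.succ).mono (ℱ.le _) le_rfl).sub ((hs t.castSucc).mono (ℱ.le _) le_rfl))

/-- Under a martingale measure, terminal gains with integrable negative part are centered. -/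
theorem integral_gains_eq_zero_of_martingale {Q : Measure Ω} [IsFiniteMeasure Q]
    (hs : ∀ t, Measurable[ℱ t] (s t)) (hx : x ∈ strategies ℱ d)
    (hM : Martingale (fun t ω => s t ω - s 0 ω) ℱ Q)
    (hneg : Integrable (fun ω => max (-gains s x ω) 0) Q) :
    Integrable (gains s x) Q ∧ ∫ ω, gains s x ω ∂Q = 0 := by
  refine integrable_sum_of_integrable_negPart T (fun t => ℱ t.castSucc)
    (fun t ω => inner ℝ (x t.castSucc ω) (s t.succ ω - s t.castSucc ω)) (fun t => ℱ.le _)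
    (fun i j hij => ?_) (fun t => ?_) hneg
  -- The `i`-th gain is known at time `i + 1`, which is at most `j` because `i < j`.
  · have h1 : i.castSucc ≤ j.castSucc := Fin.castSucc_le_castSucc_iff.2 hij.le
    have h2 : i.succ ≤ j.castSucc := Fin.succ_le_castSucc_iff.2 hij
    exact ((hx i.castSucc).mono (ℱ.mono h1) le_rfl).inner
      (((hs i.succ).mono (ℱ.mono h2) le_rfl).sub ((hs i.castSucc).mono (ℱ.mono h1) le_rfl))
  · have heq : (fun ω => s t.succ ω - s t.castSucc ω) =
        (fun ω => s t.succ ω - s 0 ω) - fun ω => s t.castSucc ω - s 0 ω := by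
      ext ω : 1
      simp
    have hint : Integrable (fun ω => s t.succ ω - s t.castSucc ω) Q := by
      rw [heq]
      exact (hM.integrable _).sub (hM.integrable _)
    refine condCentered_inner (ℱ.le _) (hx _) hint ?_
    rw [heq]
    refine (condExp_sub (hM.integrable _) (hM.integrable _) _).trans ?_
    filter_upwards [hM.2 _ _ (Fin.castSucc_lt_succ (i := t)).le, hM.2 _ _ (le_refl t.castSucc)]
      with ω h1 h2
    simp [h1, h2]

/-- If `y` is a scaled martingale density and the `y`-weighted terminal gains have integrable
negative part, then they are integrable and centered. -/
theorem integral_gains_mul_eq_zero [IsFiniteMeasure P] {Y : Submodule ℝ (Ω →ₘ[P] ℝ)}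
    (hs : ∀ t, Measurable[ℱ t] (s t)) (hx : x ∈ strategies ℱ d) {y : Ω →ₘ[P] ℝ}
    (hy : y ∈ scaledMartingaleDensities ℱ s Y)
    (hneg : Integrable (fun ω => max (-(gains s x ω * y ω)) 0) P) :
    Integrable (fun ω => gains s x ω * y ω) P ∧ ∫ ω, gains s x ω * y ω ∂P = 0 := by
  obtain ⟨-, rfl | ⟨Q, hQ, hQP, hM, c, hc, hyc⟩⟩ := hy
  · have h0 : (fun ω => gains s x ω * (0 : Ω →ₘ[P] ℝ) ω) =ᵐ[P] fun _ => 0 := by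
      filter_upwards [AEEqFun.coeFn_zero (μ := P) (β := ℝ)] with ω h
      simp [h]
    exact ⟨(integrable_zero _ _ _).congr h0.symm, by rw [integral_congr_ae h0]; simp⟩
  · have hcg : ∀ᵐ ω ∂P, (Q.rnDeriv P ω).toReal * gains s x ω = c⁻¹ * (gains s x ω * y ω) := by
      filter_upwards [hyc] with ω h
      rw [h]
      field_simp
    have hneg' : Integrable (fun ω => max (-gains s x ω) 0) Q := by
      rw [← integrable_toReal_rnDeriv_mul_iff hQP]
      refine (hneg.const_mul c⁻¹).congr ?_
      filter_upwards [hcg] with ω h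
      rw [mul_max_of_nonneg _ _ (inv_nonneg.2 hc.le), mul_max_of_nonneg _ _ ENNReal.toReal_nonneg,
        mul_neg, mul_neg, h, mul_zero, mul_zero]
    obtain ⟨h1, h2⟩ := integral_gains_eq_zero_of_martingale hs hx hM hneg'
    rw [← integrable_toReal_rnDeriv_mul_iff hQP] at h1
    rw [← integral_toReal_rnDeriv_mul hQP] at h2
    have hcg' : ∀ᵐ ω ∂P, c * ((Q.rnDeriv P ω).toReal * gains s x ω) = gains s x ω * y ω := by
      filter_upwards [hcg] with ω h
      rw [h, mul_inv_cancel_left₀ hc.ne']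
    refine ⟨(h1.const_mul c).congr hcg', ?_⟩
    rw [← integral_congr_ae hcg', integral_const_mul, h2, mul_zero]

/-- If the increments of an adapted process are integrable and centered on the sets known at their
beginnings, the normalized process is a martingale. -/
theorem martingale_of_increments {Q : Measure Ω} [IsFiniteMeasure Q]
    (hs : ∀ t, Measurable[ℱ t] (s t))
    (hint : ∀ t : Fin T, Integrable (fun ω => s t.succ ω - s t.castSucc ω) Q)
    (hzero : ∀ t : Fin T, ∀ A, MeasurableSet[ℱ t.castSucc] A →
      ∫ ω in A, (s t.succ ω - s t.castSucc ω) ∂Q = 0) :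
    Martingale (fun t ω => s t ω - s 0 ω) ℱ Q := by
  -- Induction on the later time, telescoping the increments. Only differences of prices are
  -- integrated, so `s 0` may fail to be integrable.
  have key : ∀ j i, i ≤ j → Integrable (fun ω => s j ω - s i ω) Q ∧
      ∀ A, MeasurableSet[ℱ i] A → ∫ ω in A, (s j ω - s i ω) ∂Q = 0 := by
    intro j
    induction j using Fin.induction with
    | zero =>
      intro i hi
      obtain rfl := Fin.le_zero_iff.1 hi
      simp
    | succ t ih =>
      intro i hi
      rcases eq_or_lt_of_le hi with rfl | hlt
      · simp
      · have hit : i ≤ t.castSucc := Fin.le_castSucc_iff.2 hlt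
        obtain ⟨h1, h2⟩ := ih i hit
        have heq : (fun ω => s t.succ ω - s i ω) =
            fun ω => (s t.succ ω - s t.castSucc ω) + (s t.castSucc ω - s i ω) := by
          ext ω : 1
          simp
        rw [heq]
        refine ⟨(hint t).add h1, fun A hA => ?_⟩
        rw [integral_add (hint t).integrableOn h1.integrableOn, h2 A hA,
          hzero t A (ℱ.mono hit _ hA), add_zero]
  have hadp : ∀ t, StronglyMeasurable[ℱ t] fun ω => s t ω - s 0 ω := fun t =>
    ((hs t).sub ((hs 0).mono (ℱ.mono (Fin.zero_le t)) le_rfl)).stronglyMeasurable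
  refine ⟨hadp, fun i j hij => ?_⟩
  have hi := (key i 0 (Fin.zero_le i)).1
  refine (ae_eq_condExp_of_forall_setIntegral_eq (ℱ.le i) (key j 0 (Fin.zero_le j)).1
    (fun _ _ _ => hi.integrableOn) (fun A hA _ => ?_) (hadp i).aestronglyMeasurable).symm
  have hsplit : ∀ ω, s j ω - s 0 ω = (s j ω - s i ω) + (s i ω - s 0 ω) := fun ω => by simp
  simp_rw [hsplit]
  rw [integral_add (key j i hij).1.integrableOn hi.integrableOn, (key j i hij).2 A hA, zero_add]

/-- A nonnegative integrable random variable that annihilates the elementary gains is a scaled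
martingale density. -/
theorem mem_scaledMartingaleDensities [IsProbabilityMeasure P] {Y : Submodule ℝ (Ω →ₘ[P] ℝ)}
    (hs : ∀ t, Measurable[ℱ t] (s t)) {y : Ω →ₘ[P] ℝ} (hyY : y ∈ Y) (hy0 : ∀ᵐ ω ∂P, 0 ≤ y ω)
    (hyi : Integrable y P)
    (h : ∀ (t : Fin T) (A : Set Ω) (k : Fin d), MeasurableSet[ℱ t.castSucc] A →
      Integrable (fun ω => A.indicator (fun ω => (s t.succ ω - s t.castSucc ω) k) ω * y ω) P ∧
      ∫ ω, A.indicator (fun ω => (s t.succ ω - s t.castSucc ω) k) ω * y ω ∂P = 0) :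
    y ∈ scaledMartingaleDensities ℱ s Y := by
  refine ⟨hyY, ?_⟩
  rcases eq_or_ne y 0 with hy | hy
  · exact Or.inl hy
  refine Or.inr ?_
  set c := ∫ ω, y ω ∂P with hcdef
  have hc : 0 < c := by
    refine lt_of_le_of_ne (integral_nonneg_of_ae hy0) fun hc0 => hy ?_
    have := (integral_eq_zero_iff_of_nonneg_ae hy0 hyi).1 hc0.symm
    exact AEEqFun.ext (this.trans (AEEqFun.coeFn_zero (μ := P) (β := ℝ)).symm)
  set Q := P.withDensity fun ω => ENNReal.ofReal (y ω / c) with hQdef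
  have hQP : Q ≪ P := withDensity_absolutelyContinuous _ _
  have hQprob : IsProbabilityMeasure Q := by
    refine ⟨?_⟩
    have hi := hyi.div_const c
    rw [hQdef, withDensity_apply _ MeasurableSet.univ, setLIntegral_univ,
      ← ofReal_integral_eq_lintegral_ofReal hi, integral_div, div_self hc.ne', ENNReal.ofReal_one]
    filter_upwards [hy0] with ω hω using div_nonneg hω hc.le
  have hrn : ∀ᵐ ω ∂P, (Q.rnDeriv P ω).toReal = y ω / c := by
    have := Measure.rnDeriv_withDensity P (f := fun ω => ENNReal.ofReal (y ω / c))
      (y.measurable.div_const c).ennreal_ofReal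
    filter_upwards [this, hy0] with ω h1 h2
    rw [h1, ENNReal.toReal_ofReal (div_nonneg h2 hc.le)]
  have hcoord : ∀ (t : Fin T) (A : Set Ω) (k : Fin d), MeasurableSet[ℱ t.castSucc] A →
      IntegrableOn (fun ω => (s t.succ ω - s t.castSucc ω) k) A Q ∧
        ∫ ω in A, (s t.succ ω - s t.castSucc ω) k ∂Q = 0 := by
    intro t A k hA
    obtain ⟨h1, h2⟩ := h t A k hA
    have hA' := ℱ.le _ _ hA
    have hae : ∀ᵐ ω ∂P, c⁻¹ * (A.indicator (fun ω => (s t.succ ω - s t.castSucc ω) k) ω * y ω) =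
        (Q.rnDeriv P ω).toReal * A.indicator (fun ω => (s t.succ ω - s t.castSucc ω) k) ω := by
      filter_upwards [hrn] with ω hω
      rw [hω]
      ring
    rw [← integrable_indicator_iff hA', ← integral_indicator hA',
      ← integrable_toReal_rnDeriv_mul_iff hQP, ← integral_toReal_rnDeriv_mul hQP,
      ← integral_congr_ae hae, integral_const_mul, h2, mul_zero]
    exact ⟨(h1.const_mul _).congr hae, rfl⟩
  refine ⟨Q, hQprob, hQP, martingale_of_increments hs (fun t => ?_) (fun t A hA => ?_), c, hc, ?_⟩
  · refine Integrable.of_eval_piLp fun k => ?_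
    simpa using (hcoord t Set.univ k MeasurableSet.univ).1
  · ext k
    rw [eval_integral_piLp fun k => (hcoord t A k hA).1]
    simpa using (hcoord t A k hA).2
  · filter_upwards [hrn] with ω hω
    rw [hω, mul_div_cancel₀ _ hc.ne']

end MartingaleDensities

/-! ### Extended expectations and ordinary integrals. -/

section Expectation

variable {Ω : Type*} {mΩ : MeasurableSpace Ω} {P : Measure Ω}

theorem expect_congr_ae {f g : Ω → EReal} (h : f =ᵐ[P] g) : expect P f = expect P g := by
  unfold expect
  have h1 : ∫⁻ ω, (f ω).toENNReal ∂P = ∫⁻ ω, (g ω).toENNReal ∂P :=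
    lintegral_congr_ae (h.mono fun ω hω => by simp only [hω])
  have h2 : ∫⁻ ω, (-f ω).toENNReal ∂P = ∫⁻ ω, (-g ω).toENNReal ∂P :=
    lintegral_congr_ae (h.mono fun ω hω => by simp only [hω])
  rw [h1, h2]

theorem lintegral_ne_top_of_expect_ne_top {f : Ω → EReal} (h : expect P f ≠ ⊤) :
    ∫⁻ ω, (f ω).toENNReal ∂P ≠ ⊤ := by
  intro h1
  simp [expect, h1] at h

theorem expect_coe {f : Ω → ℝ} (hf : Integrable f P) :
    expect P (fun ω => (f ω : EReal)) = ((∫ ω, f ω ∂P : ℝ) : EReal) := by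
  have h1 : ∫⁻ ω, ENNReal.ofReal (f ω) ∂P ≠ ⊤ := hf.lintegral_lt_top.ne
  have h2 : ∫⁻ ω, ENNReal.ofReal (-f ω) ∂P ≠ ⊤ := hf.neg.lintegral_lt_top.ne
  rw [expect, if_neg (by simpa only [EReal.real_coe_toENNReal] using h1)]
  simp_rw [← EReal.coe_neg, EReal.real_coe_toENNReal]
  rw [integral_eq_lintegral_pos_part_sub_lintegral_neg_part hf, EReal.coe_sub,
    EReal.coe_ennreal_toReal h1, EReal.coe_ennreal_toReal h2]

theorem integrable_of_expect_ne {f : Ω → ℝ} (hf : AEStronglyMeasurable f P)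
    (ht : expect P (fun ω => (f ω : EReal)) ≠ ⊤) (hb : expect P (fun ω => (f ω : EReal)) ≠ ⊥) :
    Integrable f P := by
  have h1 := lintegral_ne_top_of_expect_ne_top ht
  have h2 : ∫⁻ ω, (-(f ω : EReal)).toENNReal ∂P ≠ ⊤ := by
    intro h2
    rw [expect, if_neg h1, h2] at hb
    simp at hb
  simp_rw [← EReal.coe_neg, EReal.real_coe_toENNReal] at h1 h2
  refine ⟨hf, ?_⟩
  have h3 : ∫⁻ ω, ENNReal.ofReal (f ω) + ENNReal.ofReal (-f ω) ∂P ≠ ⊤ := by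
    rw [lintegral_add_left' hf.aemeasurable.ennreal_ofReal]
    exact ENNReal.add_ne_top.2 ⟨h1, h2⟩
  refine lt_of_le_of_lt (lintegral_mono fun ω => ?_) h3.lt_top
  rw [Real.enorm_eq_ofReal_abs]
  rcases le_total 0 (f ω) with h | h
  · rw [abs_of_nonneg h]; exact le_self_add
  · rw [abs_of_nonpos h]; exact le_add_self

/-- Only the positive part is controlled, so the expectation may still be `⊥`. For objectives this
is excluded by properness of the value function. -/
theorem expect_lt_top_of_le {f g : Ω → ℝ} (hg : Integrable g P) (hfg : ∀ᵐ ω ∂P, f ω ≤ g ω) :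
    expect P (fun ω => (f ω : EReal)) < ⊤ := by
  have h1 : ∫⁻ ω, ENNReal.ofReal (f ω) ∂P ≠ ⊤ := ne_top_of_le_ne_top hg.lintegral_lt_top.ne
    (lintegral_mono_ae (hfg.mono fun ω h => ENNReal.ofReal_le_ofReal h))
  simp_rw [← EReal.real_coe_toENNReal] at h1
  rw [expect, if_neg h1, ← EReal.coe_ennreal_toReal h1, sub_eq_add_neg]
  refine EReal.add_lt_top (EReal.coe_ne_top _) ?_
  rw [Ne, EReal.neg_eq_top_iff]
  exact EReal.coe_ennreal_ne_bot _

end Expectation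

/-! ### Reduction to real-valued integrands, subgradient selection and conjugates. -/

section RealDisutility

variable {Ω : Type*} [mΩ : MeasurableSpace Ω] {P : Measure Ω}

/-- A finite convex nondecreasing normal integrand vanishing at the origin. -/
structure IsRealDisutility (v : ℝ → Ω → ℝ) : Prop where
  measurable : Measurable fun p : ℝ × Ω => v p.1 p.2
  convex : ∀ ω, ConvexOn ℝ Set.univ fun ξ => v ξ ω
  monotone : ∀ ω, Monotone fun ξ => v ξ ω
  map_zero : ∀ ω, v 0 ω = 0

/-- A disutility integrand that is almost surely finite at every natural number agrees almost
surely with a finite one. -/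
theorem IsDisutility.exists_real {V : ℝ → Ω → EReal} (hV : IsDisutility V)
    (hfin : ∀ n : ℕ, ∀ᵐ ω ∂P, V n ω ≠ ⊤) :
    ∃ v : ℝ → Ω → ℝ, IsRealDisutility v ∧ ∀ᵐ ω ∂P, ∀ ξ, V ξ ω = v ξ ω := by
  classical
  -- By monotonicity, finiteness at the natural numbers gives finiteness everywhere, so a countable
  -- intersection suffices and `N` is measurable. Off `N` the integrand is replaced by zero.
  set N : Set Ω := {ω | ∀ n : ℕ, V n ω ≠ ⊤} with hN
  have hNm : MeasurableSet N := by
    have : N = ⋂ n : ℕ, {ω | V n ω ≠ ⊤} := by ext; simp [hN]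
    rw [this]
    exact MeasurableSet.iInter fun n => (hV.measurable.comp measurable_prodMk_left)
      (measurableSet_singleton (⊤ : EReal)).compl
  have hNfin : ∀ ω ∈ N, ∀ ξ, V ξ ω ≠ ⊤ := fun ω hω ξ =>
    ne_top_of_le_ne_top (hω ⌈ξ⌉₊) (hV.monotone ω (Nat.le_ceil ξ))
  have hcoe : ∀ ω ∈ N, ∀ ξ, (((V ξ ω).toReal : ℝ) : EReal) = V ξ ω := fun ω hω ξ =>
    EReal.coe_toReal (hNfin ω hω ξ) (hV.ne_bot ω ξ)
  refine ⟨fun ξ ω => if ω ∈ N then (V ξ ω).toReal else 0, ⟨?_, ?_, ?_, ?_⟩, ?_⟩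
  · exact Measurable.ite (measurable_snd hNm) hV.measurable.ereal_toReal measurable_const
  · intro ω
    by_cases hω : ω ∈ N
    · simp only [hω, if_true]
      refine ⟨convex_univ, fun a _ b _ α β hα hβ hαβ => ?_⟩
      have := hV.convex ω (x := (a, (V a ω).toReal)) (hcoe ω hω a).ge
        (y := (b, (V b ω).toReal)) (hcoe ω hω b).ge hα hβ hαβ
      simp only [Set.mem_ofPred_eq, Prod.fst_add, Prod.snd_add, Prod.smul_fst, Prod.smul_snd] at this
      rw [← hcoe ω hω, EReal.coe_le_coe_iff] at this
      exact this
    · simp only [hω, if_false]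
      exact convexOn_const 0 convex_univ
  · intro ω a b hab
    by_cases hω : ω ∈ N
    · simp only [hω, if_true]
      exact EReal.toReal_le_toReal (hV.monotone ω hab) (hV.ne_bot ω a) (hNfin ω hω b)
    · simp [hω]
  · intro ω
    simp [hV.map_zero]
  · filter_upwards [ae_all_iff.2 hfin] with ω hω ξ
    have hωN : ω ∈ N := hω
    rw [if_pos hωN, hcoe ω hωN]

namespace IsRealDisutility

variable {v : ℝ → Ω → ℝ}

theorem measurable_comp (hv : IsRealDisutility v) {f : Ω → ℝ} (hf : Measurable f) :
    Measurable fun ω => v (f ω) ω :=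
  hv.measurable.comp (hf.prodMk measurable_id)

theorem continuous (hv : IsRealDisutility v) (ω : Ω) : Continuous fun ξ => v ξ ω :=
  continuousOn_univ.1 ((hv.convex ω).continuousOn isOpen_univ)

/-- Measurable selection of subgradients. -/
theorem exists_measurable_subgradient (hv : IsRealDisutility v) {f : Ω → ℝ} (hf : Measurable f) :
    ∃ g : Ω → ℝ, Measurable g ∧ ∀ ω ξ, v (f ω) ω + (ξ - f ω) * g ω ≤ v ξ ω := by
  -- The infimum of these right difference quotients is the right derivative at `f ω`, which is a
  -- subgradient. A countable family of steps makes it measurable.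
  set q : ℕ → Ω → ℝ := fun n ω =>
    (v (f ω + 1 / (n + 1)) ω - v (f ω) ω) / (1 / (n + 1)) with hq
  have hslope : ∀ ω ξ n, ξ < f ω → (v (f ω) ω - v ξ ω) / (f ω - ξ) ≤ q n ω := by
    intro ω ξ n hξ
    have := (hv.convex ω).slope_mono_adjacent (Set.mem_univ ξ)
      (Set.mem_univ (f ω + 1 / ((n : ℝ) + 1))) hξ (lt_add_of_pos_right _ Nat.one_div_pos_of_nat)
    rwa [add_sub_cancel_left] at this
  refine ⟨fun ω => ⨅ n, q n ω, Measurable.iInf fun n => ?_, fun ω ξ => ?_⟩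
  · exact ((hv.measurable_comp (hf.add_const _)).sub (hv.measurable_comp hf)).div_const _
  rcases lt_trichotomy ξ (f ω) with h | rfl | h
  · have := le_ciInf fun n => hslope ω ξ n h
    rw [div_le_iff₀ (sub_pos.2 h)] at this
    linarith
  · simp
  · obtain ⟨n, hn⟩ := exists_nat_one_div_lt (sub_pos.2 h)
    have hpos : (0 : ℝ) < 1 / (n + 1) := Nat.one_div_pos_of_nat
    have hbdd : BddBelow (Set.range fun n => q n ω) :=
      ⟨_, by rintro _ ⟨n, rfl⟩; exact hslope ω (f ω - 1) n (by linarith)⟩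
    have h1 : ⨅ n, q n ω ≤ q n ω := ciInf_le hbdd n
    have h2 := (hv.convex ω).secant_mono (Set.mem_univ (f ω))
      (Set.mem_univ (f ω + 1 / ((n : ℝ) + 1))) (Set.mem_univ ξ) (by linarith) h.ne' (by linarith)
    rw [add_sub_cancel_left] at h2
    have h3 := h1.trans h2
    rw [le_div_iff₀ (sub_pos.2 h)] at h3
    linarith

end IsRealDisutility

/-- The conjugate integrand of a finite disutility integrand, as a supremum over rationals. -/
noncomputable def conjENN (v : ℝ → Ω → ℝ) (y : Ω → ℝ) (ω : Ω) : ℝ≥0∞ :=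
  ⨆ q : ℚ, ENNReal.ofReal (q * y ω - v q ω)

namespace IsRealDisutility

variable {v : ℝ → Ω → ℝ} {y : Ω → ℝ}

theorem measurable_conjENN (hv : IsRealDisutility v) (hy : Measurable y) :
    Measurable (conjENN v y) :=
  Measurable.iSup fun _ => ((hy.const_mul _).sub
    (hv.measurable_comp measurable_const)).ennreal_ofReal

/-- Rational arguments suffice because `v` is continuous in its first argument. The truncation at
zero in `conjENN` is harmless, since `q = 0` contributes the value zero. -/
theorem fenchel_of_conjENN_ne_top (hv : IsRealDisutility v) {ω : Ω} (h : conjENN v y ω ≠ ⊤)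
    (ξ : ℝ) :
    ξ * y ω - v ξ ω ≤ (conjENN v y ω).toReal := by
  refine Rat.denseRange_cast.induction_on
    (p := fun ξ : ℝ => ξ * y ω - v ξ ω ≤ (conjENN v y ω).toReal) ξ ?_ fun q => ?_
  · exact isClosed_le ((continuous_id.mul continuous_const).sub (hv.continuous ω)) continuous_const
  · rw [← ENNReal.ofReal_le_iff_le_toReal h]
    exact le_iSup (fun q : ℚ => ENNReal.ofReal (q * y ω - v q ω)) q

theorem exists_integrable_conj (hv : IsRealDisutility v) (hy : Measurable y)
    (h : ∫⁻ ω, conjENN v y ω ∂P ≠ ⊤) :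
    Integrable (fun ω => (conjENN v y ω).toReal) P ∧
      (∀ᵐ ω ∂P, ∀ ξ, ξ * y ω - v ξ ω ≤ (conjENN v y ω).toReal) ∧
      ∫ ω, (conjENN v y ω).toReal ∂P = (∫⁻ ω, conjENN v y ω ∂P).toReal := by
  have hm := hv.measurable_conjENN hy
  have hfin := ae_lt_top hm h
  exact ⟨integrable_toReal_of_lintegral_ne_top hm.aemeasurable h,
    hfin.mono fun ω hω => hv.fenchel_of_conjENN_ne_top hω.ne, integral_toReal hm.aemeasurable hfin⟩

theorem lintegral_conjENN_ne_top {V : ℝ → Ω → EReal} (hVv : ∀ᵐ ω ∂P, ∀ ξ, V ξ ω = v ξ ω)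
    (h : expect P (fun ω => conj V (y ω) ω) ≠ ⊤) : ∫⁻ ω, conjENN v y ω ∂P ≠ ⊤ := by
  refine ne_top_of_le_ne_top (lintegral_ne_top_of_expect_ne_top h) (lintegral_mono_ae ?_)
  filter_upwards [hVv] with ω hω
  refine iSup_le fun q => ?_
  rw [← EReal.real_coe_toENNReal, EReal.coe_sub, ← hω]
  exact EReal.toENNReal_le_toENNReal
    (le_iSup (fun ξ : ℝ => ((ξ * y ω : ℝ) : EReal) - V ξ ω) (q : ℝ))

end IsRealDisutility

end RealDisutility

/-! ### Integral functionals on decomposable spaces: closedness and interchange. -/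

section Decomposable

open Filter

variable {Ω : Type*} [mΩ : MeasurableSpace Ω] {P : Measure Ω} {U Y : Submodule ℝ (Ω →ₘ[P] ℝ)}
  {v : ℝ → Ω → ℝ}

/-- A decomposable space contains the random variables that agree with one of its elements off a
measurable set on which they are bounded. -/
theorem Decomposable.exists_piecewise (hU : Decomposable U) {A : Set Ω} (hA : MeasurableSet A)
    {f : Ω → ℝ} (hf : Measurable f) {C : ℝ} (hC : ∀ ω ∈ A, |f ω| ≤ C) {u : Ω →ₘ[P] ℝ}
    (hu : u ∈ U) :
    ∃ w ∈ U, ∀ᵐ ω ∂P, (ω ∈ A → w ω = f ω) ∧ (ω ∉ A → w ω = u ω) := by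
  have hfA : Measurable (A.indicator f) := hf.indicator hA
  have hwm : Measurable fun ω => Aᶜ.indicator u ω + A.indicator f ω :=
    (u.measurable.indicator hA.compl).add hfA
  have hfe := AEEqFun.coeFn_mk (A.indicator f) hfA.aestronglyMeasurable (μ := P)
  have hwe := AEEqFun.coeFn_mk _ hwm.aestronglyMeasurable (μ := P)
  refine ⟨AEEqFun.mk _ hwm.aestronglyMeasurable, hU Aᶜ hA.compl u hu
    (AEEqFun.mk (A.indicator f) hfA.aestronglyMeasurable) ?_ _ ?_, ?_⟩
  · refine memLp_top_of_bound (AEEqFun.aestronglyMeasurable _) |C| ?_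
    filter_upwards [hfe] with ω h
    rw [h, Real.norm_eq_abs]
    by_cases hω : ω ∈ A
    · rw [Set.indicator_of_mem hω]; exact (hC ω hω).trans (le_abs_self C)
    · rw [Set.indicator_of_notMem hω, abs_zero]; exact abs_nonneg C
  · filter_upwards [hfe, hwe] with ω h1 h2
    rw [h2, compl_compl]
    by_cases hω : ω ∈ A
    · rw [Set.indicator_of_mem hω (AEEqFun.cast _), h1]
    · simp [hω]
  · filter_upwards [hwe] with ω h
    rw [h]
    exact ⟨fun hω => by simp [hω], fun hω => by simp [hω]⟩

/-- A decomposable space contains the bounded random variables. -/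
theorem Decomposable.exists_bounded (hU : Decomposable U) {f : Ω → ℝ} (hf : Measurable f) {C : ℝ}
    (hC : ∀ ω, |f ω| ≤ C) : ∃ w ∈ U, w =ᵐ[P] f := by
  obtain ⟨w, hw, h⟩ := hU.exists_piecewise MeasurableSet.univ hf (fun ω _ => hC ω) U.zero_mem
  exact ⟨w, hw, h.mono fun ω h => h.1 (Set.mem_univ ω)⟩

/-- The pairing with a fixed element as a linear functional. -/
noncomputable def pairingLinear (y : Ω →ₘ[P] ℝ)
    (hy : ∀ u ∈ U, Integrable (fun ω => u ω * y ω) P) : U →ₗ[ℝ] ℝ where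
  toFun u := pairing (u : Ω →ₘ[P] ℝ) y
  map_add' a b := by
    unfold pairing
    rw [← integral_add (hy a a.2) (hy b b.2)]
    refine integral_congr_ae ?_
    filter_upwards [AEEqFun.coeFn_add (a : Ω →ₘ[P] ℝ) b] with ω h
    rw [Submodule.coe_add, h, Pi.add_apply, add_mul]
  map_smul' c a := by
    unfold pairing
    rw [RingHom.id_apply, smul_eq_mul, ← integral_const_mul]
    refine integral_congr_ae ?_
    filter_upwards [AEEqFun.coeFn_smul c (a : Ω →ₘ[P] ℝ)] with ω h
    rw [Submodule.coe_smul, h, Pi.smul_apply, smul_eq_mul, mul_assoc]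

/-- The integral functional of a finite disutility integrand is the supremum of continuous affine
minorants. -/
theorem IsRealDisutility.exists_affine_minorant (hv : IsRealDisutility v) (hY : Decomposable Y)
    {u : Ω →ₘ[P] ℝ} (hu : ∀ y ∈ Y, Integrable (fun ω => u ω * y ω) P)
    (hvu : Integrable (fun ω => v (u ω) ω) P) {y₀ : Ω →ₘ[P] ℝ} (hy₀ : y₀ ∈ Y) {D : Ω → ℝ}
    (hD : Integrable D P) (hyD : ∀ᵐ ω ∂P, ∀ ξ, ξ * y₀ ω - v ξ ω ≤ D ω) {r : ℝ}
    (hr : r < ∫ ω, v (u ω) ω ∂P) :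
    ∃ y ∈ Y, ∃ w : Ω → ℝ, Integrable w P ∧ (∀ᵐ ω ∂P, ∀ ξ, ξ * y ω - w ω ≤ v ξ ω) ∧
      r < pairing u y - ∫ ω, w ω ∂P := by
  -- The selection `g` need not lie in `Y`. It is kept where it is bounded by `n` and replaced by
  -- `y₀` elsewhere, and the loss vanishes as `n` grows.
  obtain ⟨g, hg, hgv⟩ := hv.exists_measurable_subgradient u.measurable
  have hA := aecover_norm_le P hg
  set k : Ω → ℝ := fun ω => u ω * y₀ ω - D ω with hk
  have hki : Integrable k P := (hu y₀ hy₀).sub hD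
  have hlim : Tendsto (fun n : ℕ => ∫ ω in {ω | ‖g ω‖ ≤ n}, (v (u ω) ω - k ω) ∂P + ∫ ω, k ω ∂P)
      atTop (nhds (∫ ω, v (u ω) ω ∂P)) := by
    have := (hA.integral_tendsto_of_countably_generated (hvu.sub hki)).add_const (∫ ω, k ω ∂P)
    rw [integral_sub' hvu hki, sub_add_cancel] at this
    exact this
  obtain ⟨n, hn⟩ := (hlim.eventually (lt_mem_nhds hr)).exists
  have hAm : MeasurableSet {ω | ‖g ω‖ ≤ n} := hA.measurableSet n
  set A := {ω | ‖g ω‖ ≤ n} with hAdef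
  obtain ⟨y, hyY, hy⟩ := hY.exists_piecewise hAm hg (C := n) (fun ω hω => hω) hy₀
  -- On `A` this is `u y - v(u)`, the conjugate value at a subgradient; off `A` it is `D`.
  set w : Ω → ℝ := fun ω => u ω * y ω - (A.indicator (fun ω => v (u ω) ω - k ω) ω + k ω) with hw
  have hsub : Integrable (fun ω => v (u ω) ω - k ω) P := hvu.sub hki
  have hind : Integrable (fun ω => A.indicator (fun ω => v (u ω) ω - k ω) ω + k ω) P :=
    (hsub.indicator hAm).add hki
  refine ⟨y, hyY, w, (hu y hyY).sub hind, ?_, ?_⟩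
  · filter_upwards [hy, hyD] with ω h1 h2 ξ
    by_cases hω : ω ∈ A
    · have := hgv ω ξ
      simp only [hw, Set.indicator_of_mem hω, h1.1 hω]
      linarith
    · have := h2 ξ
      simp only [hw, Set.indicator_of_notMem hω, h1.2 hω, hk]
      linarith
  · rw [hw, integral_sub (hu y hyY) hind, integral_add (hsub.indicator hAm) hki,
      integral_indicator hAm, pairing]
    simpa using hn

/-- Sublevel sets of the integral functional of a finite disutility integrand are closed in any
topology in which the functionals given by the elements of `Y` are continuous. -/
theorem IsRealDisutility.isClosed_sublevel [TopologicalSpace U] (hv : IsRealDisutility v)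
    (hY : Decomposable Y) (hUY : ∀ u ∈ U, ∀ y ∈ Y, Integrable (fun ω => u ω * y ω) P)
    (hcont : ∀ y ∈ Y, Continuous fun u : U => pairing (u : Ω →ₘ[P] ℝ) y)
    (hvU : ∀ u ∈ U, Integrable (fun ω => v (u ω) ω) P) {y₀ : Ω →ₘ[P] ℝ} (hy₀ : y₀ ∈ Y)
    {D : Ω → ℝ} (hD : Integrable D P) (hyD : ∀ᵐ ω ∂P, ∀ ξ, ξ * y₀ ω - v ξ ω ≤ D ω) (r : ℝ) :
    IsClosed {u : U | ∫ ω, v ((u : Ω →ₘ[P] ℝ) ω) ω ∂P ≤ r} := by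
  refine isOpen_compl_iff.1 (isOpen_iff_mem_nhds.2 fun u hu => ?_)
  have hu' : r < ∫ ω, v ((u : Ω →ₘ[P] ℝ) ω) ω ∂P := not_le.1 hu
  obtain ⟨y, hy, w, hw, hyw, hlt⟩ :=
    hv.exists_affine_minorant hY (hUY u u.2) (hvU u u.2) hy₀ hD hyD hu'
  filter_upwards [((hcont y hy).sub continuous_const).continuousAt.eventually
    (lt_mem_nhds hlt)] with u' hu'
  refine not_le.2 (hu'.trans_le ?_)
  change ∫ ω, (u' : Ω →ₘ[P] ℝ) ω * y ω ∂P - _ ≤ _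
  rw [← integral_sub (hUY u' u'.2 y hy) hw]
  refine integral_mono_ae ((hUY u' u'.2 y hy).sub hw) (hvU u' u'.2) ?_
  filter_upwards [hyw] with ω h using h _

/-- Half of the interchange rule for minimization and integration. -/
theorem IsRealDisutility.integral_max_le (hv : IsRealDisutility v) (hU : Decomposable U)
    {y : Ω →ₘ[P] ℝ} (hy : ∀ u ∈ U, Integrable (fun ω => u ω * y ω) P)
    (hvU : ∀ u ∈ U, Integrable (fun ω => v (u ω) ω) P) {g : Ω → ℝ} (hg : Measurable g) {K : ℝ}
    (hK : ∀ u ∈ U, Integrable (fun ω => v (u ω - g ω) ω) P →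
      pairing u y - ∫ ω, v (u ω - g ω) ω ∂P ≤ K)
    {u : Ω →ₘ[P] ℝ} (hu : u ∈ U) (hvu : Integrable (fun ω => v (u ω - g ω) ω) P)
    {ξ : Ω → ℝ} (hξ : Measurable ξ) {C : ℝ} (hC : ∀ ω, |ξ ω| ≤ C) :
    Integrable (fun ω => max (ξ ω * y ω - v (ξ ω) ω + g ω * y ω) (u ω * y ω - v (u ω - g ω) ω)) P ∧
      ∫ ω, max (ξ ω * y ω - v (ξ ω) ω + g ω * y ω) (u ω * y ω - v (u ω - g ω) ω) ∂P ≤ K := by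
  set e : Ω → ℝ := fun ω => ξ ω * y ω - v (ξ ω) ω + g ω * y ω with he
  set k : Ω → ℝ := fun ω => u ω * y ω - v (u ω - g ω) ω with hk
  have hki : Integrable k P := (hy u hu).sub hvu
  have hem : Measurable e := ((hξ.mul y.measurable).sub (hv.measurable_comp hξ)).add
    (hg.mul y.measurable)
  have hkm : Measurable k := (u.measurable.mul y.measurable).sub
    (hv.measurable_comp (u.measurable.sub hg))
  have hA := aecover_norm_le P hg
  obtain ⟨ξ', hξ'U, hξ'⟩ := hU.exists_bounded hξ hC
  have hvξ : Integrable (fun ω => v (ξ ω) ω) P :=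
    (hvU ξ' hξ'U).congr (hξ'.mono fun ω h => by simp only [h])
  have key : ∀ n : ℕ, IntegrableOn (fun ω => max (e ω) (k ω) - k ω) {ω | ‖g ω‖ ≤ n} P ∧
      ∫ ω in {ω | ‖g ω‖ ≤ n}, (max (e ω) (k ω) - k ω) ∂P ≤ K - ∫ ω, k ω ∂P := by
    intro n
    have hAm : MeasurableSet {ω | ‖g ω‖ ≤ n} := hA.measurableSet n
    set A := {ω | ‖g ω‖ ≤ n} with hAdef
    have hBm : MeasurableSet (A ∩ {ω | k ω ≤ e ω}) := hAm.inter (measurableSet_le hkm hem)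
    set B := A ∩ {ω | k ω ≤ e ω} with hB
    -- The competitor `u'` equals `ξ + g` where this improves on `u` and `g` is bounded by `n`, so
    -- that it stays in `U`. Subtracting `g` leaves `ξ` there, and `v(ξ)` is integrable.
    obtain ⟨u', hu'U, hu'⟩ := hU.exists_piecewise hBm (hξ.add hg) (C := C + n)
      (fun ω hω => (abs_add_le _ _).trans (add_le_add (hC ω) hω.1)) hu
    have hvu'eq : ∀ᵐ ω ∂P, B.indicator (fun ω => v (ξ ω) ω) ω +
        Bᶜ.indicator (fun ω => v (u ω - g ω) ω) ω = v (u' ω - g ω) ω := by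
      filter_upwards [hu'] with ω h
      by_cases hω : ω ∈ B
      · simp [hω, h.1 hω]
      · simp [hω, h.2 hω]
    have hvu' : Integrable (fun ω => v (u' ω - g ω) ω) P :=
      ((hvξ.indicator hBm).add (hvu.indicator hBm.compl)).congr hvu'eq
    have hk' : Integrable (fun ω => u' ω * y ω - v (u' ω - g ω) ω) P := (hy u' hu'U).sub hvu'
    have hdiff : ∀ᵐ ω ∂P, (u' ω * y ω - v (u' ω - g ω) ω) - k ω =
        A.indicator (fun ω => max (e ω) (k ω) - k ω) ω := by
      filter_upwards [hu'] with ω h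
      by_cases hω : ω ∈ B
      · rw [h.1 hω, Set.indicator_of_mem hω.1, max_eq_left hω.2]
        simp only [he, Pi.add_apply, add_sub_cancel_right]
        ring
      · rw [h.2 hω]
        by_cases hωA : ω ∈ A
        · have : ¬ k ω ≤ e ω := fun hke => hω ⟨hωA, hke⟩
          rw [Set.indicator_of_mem hωA, max_eq_right (not_le.1 this).le]
        · rw [Set.indicator_of_notMem hωA]
          simp [hk]
    have hi := (hk'.sub hki).congr hdiff
    refine ⟨(integrable_indicator_iff hAm).1 hi, ?_⟩
    rw [← integral_indicator hAm, ← integral_congr_ae hdiff, integral_sub hk' hki,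
      integral_sub (hy u' hu'U) hvu']
    exact sub_le_sub_right (hK u' hu'U hvu') _
  have hfi : Integrable (fun ω => max (e ω) (k ω) - k ω) P :=
    hA.integrable_of_integral_bounded_of_nonneg_ae _ (fun n => (key n).1)
      (ae_of_all _ fun ω => sub_nonneg.2 (le_max_right _ _))
      (Eventually.of_forall fun n => (key n).2)
  have hle := le_of_tendsto (hA.integral_tendsto_of_countably_generated hfi)
    (Eventually.of_forall fun n => (key n).2)
  have hmax : Integrable (fun ω => max (e ω) (k ω)) P :=
    (hfi.add hki).congr (ae_of_all _ fun ω => by simp)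
  refine ⟨hmax, ?_⟩
  rw [integral_sub hmax hki] at hle
  linarith

/-- If the mean of `ξ y - v(ξ)` is bounded over bounded `ξ`, then the mean of the conjugate
integrand obeys the same bound. -/
theorem IsRealDisutility.lintegral_conjENN_le (hv : IsRealDisutility v) {y : Ω → ℝ}
    (hy : Measurable y) {K : ℝ}
    (h : ∀ ξ : Ω → ℝ, Measurable ξ → (∃ C : ℝ, ∀ ω, |ξ ω| ≤ C) →
      Integrable (fun ω => max (ξ ω * y ω - v (ξ ω) ω) 0) P ∧
        ∫ ω, max (ξ ω * y ω - v (ξ ω) ω) 0 ∂P ≤ K) :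
    ∫⁻ ω, conjENN v y ω ∂P ≤ ENNReal.ofReal K := by
  obtain ⟨e, he⟩ := exists_surjective_nat ℚ
  -- A running maximizer over the first `n` rationals, starting from `0`; taking finitely many
  -- values keeps it bounded.
  have hsel : ∀ n : ℕ, ∃ ξ : Ω → ℝ, Measurable ξ ∧ (∃ C : ℝ, ∀ ω, |ξ ω| ≤ C) ∧
      ∀ i < n, ∀ ω, (e i : ℝ) * y ω - v (e i) ω ≤ ξ ω * y ω - v (ξ ω) ω := by
    intro n
    induction n with
    | zero => exact ⟨fun _ => 0, measurable_const, ⟨0, by simp⟩, by simp⟩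
    | succ n ih =>
      obtain ⟨ξ, hξ, ⟨C, hC⟩, hle⟩ := ih
      have hS : MeasurableSet {ω | ξ ω * y ω - v (ξ ω) ω < (e n : ℝ) * y ω - v (e n) ω} :=
        measurableSet_lt ((hξ.mul hy).sub (hv.measurable_comp hξ))
          ((hy.const_mul _).sub (hv.measurable_comp measurable_const))
      refine ⟨fun ω => if ξ ω * y ω - v (ξ ω) ω < (e n : ℝ) * y ω - v (e n) ω then (e n : ℝ)
        else ξ ω, Measurable.ite hS measurable_const hξ, ⟨max C |(e n : ℝ)|, fun ω => ?_⟩,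
        fun i hi ω => ?_⟩
      · beta_reduce
        split_ifs
        · exact le_max_right _ _
        · exact (hC ω).trans (le_max_left _ _)
      · beta_reduce
        rcases Nat.lt_succ_iff_lt_or_eq.1 hi with hi | rfl
        · have := hle i hi ω
          split_ifs with hlt
          · exact this.trans hlt.le
          · exact this
        · split_ifs with hlt
          · exact le_rfl
          · exact not_lt.1 hlt
  choose ξ hξ hC hle using hsel
  have hpt : ∀ ω, conjENN v y ω ≤
      liminf (fun n => ENNReal.ofReal (max (ξ n ω * y ω - v (ξ n ω) ω) 0)) atTop := by
    intro ω
    refine iSup_le fun q => ?_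
    obtain ⟨i, rfl⟩ := he q
    refine le_liminf_of_le (by isBoundedDefault) ?_
    filter_upwards [eventually_gt_atTop i] with n hn
    exact ENNReal.ofReal_le_ofReal ((hle n i hn ω).trans (le_max_left _ _))
  -- Fatou's lemma carries the bound from the approximate maximizers to the conjugate.
  refine (lintegral_mono hpt).trans ((lintegral_liminf_le fun n => ?_).trans ?_)
  · exact (((hξ n).mul hy).sub (hv.measurable_comp (hξ n))).max measurable_const |>.ennreal_ofReal
  · refine liminf_le_of_le (by isBoundedDefault) fun b hb => ?_
    obtain ⟨n, hn⟩ := hb.exists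
    refine hn.trans ?_
    obtain ⟨hi, hK⟩ := h (ξ n) (hξ n) (hC n)
    rw [← ofReal_integral_eq_lintegral_ofReal hi (ae_of_all _ fun ω => le_max_right _ _)]
    exact ENNReal.ofReal_le_ofReal hK

end Decomposable

/-! ### Convexity and subdifferentiability of the value function. -/

section ValueFunction

theorem gains_add_smul {Ω : Type*} {T d : ℕ} {s : Fin (T + 1) → Ω → EuclideanSpace ℝ (Fin d)}
    (x x' : Fin (T + 1) → Ω → EuclideanSpace ℝ (Fin d)) (a b : ℝ) (ω : Ω) :
    gains s (a • x + b • x') ω = a * gains s x ω + b * gains s x' ω := by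
  simp only [gains, Finset.mul_sum, ← Finset.sum_add_distrib]
  refine Finset.sum_congr rfl fun t _ => ?_
  simp only [Pi.add_apply, Pi.smul_apply, inner_add_left, real_inner_smul_left]

theorem gains_zero {Ω : Type*} {T d : ℕ} {s : Fin (T + 1) → Ω → EuclideanSpace ℝ (Fin d)}
    (ω : Ω) : gains s 0 ω = 0 := by simp [gains]

variable {Ω : Type*} [mΩ : MeasurableSpace Ω] {P : Measure Ω} {T d : ℕ}
  {ℱ : Filtration (Fin (T + 1)) mΩ} {U Y : Submodule ℝ (Ω →ₘ[P] ℝ)}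
  {s : Fin (T + 1) → Ω → EuclideanSpace ℝ (Fin d)} {V : ℝ → Ω → EReal} {v : ℝ → Ω → ℝ}

theorem valueFunction_le {x : Fin (T + 1) → Ω → EuclideanSpace ℝ (Fin d)}
    (hx : x ∈ strategies ℱ d) (u : Ω → ℝ) : valueFunction P ℱ s V u ≤ objective P s V x u :=
  iInf₂_le x hx

theorem objective_eq_expect (hVv : ∀ᵐ ω ∂P, ∀ ξ, V ξ ω = v ξ ω)
    (x : Fin (T + 1) → Ω → EuclideanSpace ℝ (Fin d)) (u : Ω → ℝ) :
    objective P s V x u = expect P fun ω => ((v (u ω - gains s x ω) ω : ℝ) : EReal) :=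
  expect_congr_ae (hVv.mono fun _ h => h _)

theorem objective_eq_integral (hVv : ∀ᵐ ω ∂P, ∀ ξ, V ξ ω = v ξ ω)
    {x : Fin (T + 1) → Ω → EuclideanSpace ℝ (Fin d)} {u : Ω → ℝ}
    (h : Integrable (fun ω => v (u ω - gains s x ω) ω) P) :
    objective P s V x u = ((∫ ω, v (u ω - gains s x ω) ω ∂P : ℝ) : EReal) := by
  rw [objective_eq_expect hVv, expect_coe h]

/-- At feasible strategies the objective is a genuine integral. -/
theorem integrable_of_objective_lt_top (hv : IsRealDisutility v)
    (hVv : ∀ᵐ ω ∂P, ∀ ξ, V ξ ω = v ξ ω) (hs : ∀ t, Measurable[ℱ t] (s t))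
    {x : Fin (T + 1) → Ω → EuclideanSpace ℝ (Fin d)} (hx : x ∈ strategies ℱ d) {u : Ω →ₘ[P] ℝ}
    (hφ : valueFunction P ℱ s V u ≠ ⊥) (h : objective P s V x u < ⊤) :
    Integrable (fun ω => v (u ω - gains s x ω) ω) P := by
  have hb : objective P s V x u ≠ ⊥ := fun h => hφ (le_bot_iff.1 (h ▸ valueFunction_le hx _))
  rw [objective_eq_expect hVv] at h hb
  exact integrable_of_expect_ne (hv.measurable_comp
    (u.measurable.sub (measurable_gains hs hx))).aestronglyMeasurable h.ne hb

theorem zero_mem_strategies : (0 : Fin (T + 1) → Ω → EuclideanSpace ℝ (Fin d)) ∈ strategies ℱ d :=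
  fun t => @measurable_const (EuclideanSpace ℝ (Fin d)) Ω _ (ℱ t) 0

theorem strategies_add_smul {x x' : Fin (T + 1) → Ω → EuclideanSpace ℝ (Fin d)}
    (hx : x ∈ strategies ℱ d) (hx' : x' ∈ strategies ℱ d) (a b : ℝ) :
    a • x + b • x' ∈ strategies ℱ d := fun t =>
  ((hx t).const_smul a).add ((hx' t).const_smul b)

theorem IsRealDisutility.convexOn_integral (hv : IsRealDisutility v)
    (hvU : ∀ u ∈ U, Integrable (fun ω => v (u ω) ω) P) :
    ConvexOn ℝ Set.univ fun u : U => ∫ ω, v ((u : Ω →ₘ[P] ℝ) ω) ω ∂P := by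
  refine ⟨convex_univ, fun u₁ _ u₂ _ a b ha hb hab => ?_⟩
  simp only [smul_eq_mul]
  rw [← integral_const_mul, ← integral_const_mul,
    ← integral_add ((hvU u₁ u₁.2).const_mul a) ((hvU u₂ u₂.2).const_mul b)]
  refine integral_mono_ae (hvU _ (a • u₁ + b • u₂).2)
    (((hvU u₁ u₁.2).const_mul a).add ((hvU u₂ u₂.2).const_mul b)) ?_
  filter_upwards [AEEqFun.coeFn_add (a • (u₁ : Ω →ₘ[P] ℝ)) (b • (u₂ : Ω →ₘ[P] ℝ)),
    AEEqFun.coeFn_smul a (u₁ : Ω →ₘ[P] ℝ), AEEqFun.coeFn_smul b (u₂ : Ω →ₘ[P] ℝ)] with ω h1 h2 h3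
  rw [Submodule.coe_add, Submodule.coe_smul, Submodule.coe_smul, h1, Pi.add_apply, h2, h3]
  exact (hv.convex ω).2 (Set.mem_univ _) (Set.mem_univ _) ha hb hab

/-- The zero strategy bounds the value function by `EV`, so on `U` it is real-valued and `toReal`
loses nothing. -/
theorem coe_toReal_valueFunction (hVv : ∀ᵐ ω ∂P, ∀ ξ, V ξ ω = v ξ ω)
    (hvU : ∀ u ∈ U, Integrable (fun ω => v (u ω) ω) P)
    (hφ : ∀ u ∈ U, valueFunction P ℱ s V u ≠ ⊥) {u : Ω →ₘ[P] ℝ} (hu : u ∈ U) :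
    ((valueFunction P ℱ s V u).toReal : EReal) = valueFunction P ℱ s V u ∧
      (valueFunction P ℱ s V u).toReal ≤ ∫ ω, v (u ω) ω ∂P := by
  have h0 : valueFunction P ℱ s V u ≤ ((∫ ω, v (u ω) ω ∂P : ℝ) : EReal) := by
    have := objective_eq_integral (s := s) (x := 0) (u := u) hVv (by simpa [gains_zero] using hvU u hu)
    simp only [gains_zero, sub_zero] at this
    exact this ▸ valueFunction_le zero_mem_strategies _
  have h1 : ((valueFunction P ℱ s V u).toReal : EReal) = valueFunction P ℱ s V u :=
    EReal.coe_toReal (h0.trans_lt (EReal.coe_lt_top _)).ne (hφ u hu)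
  exact ⟨h1, EReal.coe_le_coe_iff.1 (h1 ▸ h0)⟩

/-- The optimal value function is convex. -/
theorem convexOn_valueFunction (hv : IsRealDisutility v) (hVv : ∀ᵐ ω ∂P, ∀ ξ, V ξ ω = v ξ ω)
    (hs : ∀ t, Measurable[ℱ t] (s t)) (hvU : ∀ u ∈ U, Integrable (fun ω => v (u ω) ω) P)
    (hφ : ∀ u ∈ U, valueFunction P ℱ s V u ≠ ⊥) :
    ConvexOn ℝ Set.univ fun u : U => (valueFunction P ℱ s V (u : Ω →ₘ[P] ℝ)).toReal := by
  have happrox : ∀ u : U, ∀ ε : ℝ, 0 < ε → ∃ x ∈ strategies ℱ d,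
      Integrable (fun ω => v ((u : Ω →ₘ[P] ℝ) ω - gains s x ω) ω) P ∧
      ∫ ω, v ((u : Ω →ₘ[P] ℝ) ω - gains s x ω) ω ∂P <
        (valueFunction P ℱ s V (u : Ω →ₘ[P] ℝ)).toReal + ε := by
    intro u ε hε
    set c := (valueFunction P ℱ s V (u : Ω →ₘ[P] ℝ)).toReal with hc
    have h1 : valueFunction P ℱ s V (u : Ω →ₘ[P] ℝ) < ((c + ε : ℝ) : EReal) := by
      rw [← (coe_toReal_valueFunction hVv hvU hφ u.2).1, EReal.coe_lt_coe_iff]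
      exact lt_add_of_pos_right _ hε
    simp only [valueFunction, iInf_lt_iff, exists_prop] at h1
    obtain ⟨x, hx, hlt⟩ := h1
    have hi := integrable_of_objective_lt_top hv hVv hs hx (hφ u u.2)
      (hlt.trans (EReal.coe_lt_top _))
    rw [objective_eq_integral hVv hi, EReal.coe_lt_coe_iff] at hlt
    exact ⟨x, hx, hi, hlt⟩
  refine ⟨convex_univ, fun u₁ _ u₂ _ a b ha hb hab => le_of_forall_pos_le_add fun ε hε => ?_⟩
  obtain ⟨x₁, hx₁, hi₁, hlt₁⟩ := happrox u₁ ε hε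
  obtain ⟨x₂, hx₂, hi₂, hlt₂⟩ := happrox u₂ ε hε
  have hx := strategies_add_smul hx₁ hx₂ a b
  have hsum := (hi₁.const_mul a).add (hi₂.const_mul b)
  have hle : ∀ᵐ ω ∂P, v (((a • u₁ + b • u₂ : U) : Ω →ₘ[P] ℝ) ω - gains s (a • x₁ + b • x₂) ω) ω ≤
      a * v ((u₁ : Ω →ₘ[P] ℝ) ω - gains s x₁ ω) ω + b * v ((u₂ : Ω →ₘ[P] ℝ) ω - gains s x₂ ω) ω := by
    filter_upwards [AEEqFun.coeFn_add (a • (u₁ : Ω →ₘ[P] ℝ)) (b • (u₂ : Ω →ₘ[P] ℝ)),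
      AEEqFun.coeFn_smul a (u₁ : Ω →ₘ[P] ℝ), AEEqFun.coeFn_smul b (u₂ : Ω →ₘ[P] ℝ)] with ω h1 h2 h3
    have := (hv.convex ω).2 (Set.mem_univ ((u₁ : Ω →ₘ[P] ℝ) ω - gains s x₁ ω))
      (Set.mem_univ ((u₂ : Ω →ₘ[P] ℝ) ω - gains s x₂ ω)) ha hb hab
    rw [Submodule.coe_add, Submodule.coe_smul, Submodule.coe_smul, h1, Pi.add_apply, h2, h3,
      gains_add_smul, Pi.smul_apply, Pi.smul_apply, smul_eq_mul, smul_eq_mul]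
    simp only [smul_eq_mul] at this
    rwa [mul_sub, mul_sub, sub_add_sub_comm] at this
  -- Convexity bounds the integrand only from above. Integrability of its negative part comes from
  -- the value function not being `⊥`.
  have hlt : objective P s V (a • x₁ + b • x₂) ((a • u₁ + b • u₂ : U) : Ω →ₘ[P] ℝ) < ⊤ := by
    rw [objective_eq_expect hVv]
    exact expect_lt_top_of_le hsum hle
  have hφ' := hφ _ (a • u₁ + b • u₂).2
  have hi := integrable_of_objective_lt_top hv hVv hs hx hφ' hlt
  have h1 := valueFunction_le (P := P) (s := s) (V := V) hx ((a • u₁ + b • u₂ : U) : Ω →ₘ[P] ℝ)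
  rw [objective_eq_integral hVv hi,
    ← (coe_toReal_valueFunction hVv hvU hφ (a • u₁ + b • u₂).2).1, EReal.coe_le_coe_iff] at h1
  have h2 := integral_mono_ae hi hsum hle
  rw [integral_add' (hi₁.const_mul a) (hi₂.const_mul b), integral_const_mul,
    integral_const_mul] at h2
  have h3 := mul_le_mul_of_nonneg_left hlt₁.le ha
  have h4 := mul_le_mul_of_nonneg_left hlt₂.le hb
  have h5 : a * ε + b * ε = ε := by rw [← add_mul, hab, one_mul]
  simp only [smul_eq_mul]
  linarith

/-- The optimal value function is subdifferentiable. -/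
theorem exists_subgradient_valueFunction (hv : IsRealDisutility v)
    (hVv : ∀ᵐ ω ∂P, ∀ ξ, V ξ ω = v ξ ω) (hs : ∀ t, Measurable[ℱ t] (s t))
    (hvU : ∀ u ∈ U, Integrable (fun ω => v (u ω) ω) P)
    (hφ : ∀ u ∈ U, valueFunction P ℱ s V u ≠ ⊥) (hY : Decomposable Y)
    (hUY : ∀ u ∈ U, ∀ y ∈ Y, Integrable (fun ω => u ω * y ω) P) (hbar : Barreled U Y)
    {y₀ : Ω →ₘ[P] ℝ} (hy₀ : y₀ ∈ Y) (hD : ∫⁻ ω, conjENN v y₀ ω ∂P ≠ ⊤)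
    {u : Ω →ₘ[P] ℝ} (hu : u ∈ U) :
    ∃ y ∈ Y, ∀ u' ∈ U, (valueFunction P ℱ s V u).toReal + (pairing u' y - pairing u y) ≤
      (valueFunction P ℱ s V u').toReal := by
  obtain ⟨τ, h1, h2, -, h4, h5⟩ := hbar
  have hcont : ∀ y ∈ Y, Continuous fun u : U => pairing (u : Ω →ₘ[P] ℝ) y := fun y hy =>
    -- Compatibility of the topology is used twice: here elements of `Y` give continuous
    -- functionals, and below the continuous subgradient is represented by an element of `Y`.
    (h4 (pairingLinear y fun u hu => hUY u hu y hy)).2 ⟨y, hy, fun _ => rfl⟩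
  obtain ⟨hDi, hDy, -⟩ := hv.exists_integrable_conj y₀.measurable hD
  have h0 : ∫ ω, v (((0 : U) : Ω →ₘ[P] ℝ) ω) ω ∂P = 0 := by
    refine integral_eq_zero_of_ae ?_
    filter_upwards [AEEqFun.coeFn_zero (μ := P) (β := ℝ)] with ω h
    rw [Submodule.coe_zero, h, Pi.zero_apply, hv.map_zero]
  obtain ⟨ℓ, hℓc, hℓ⟩ := exists_continuous_subgradient
    (convexOn_valueFunction hv hVv hs hvU hφ) (hv.convexOn_integral hvU)
    (fun u => (coe_toReal_valueFunction hVv hvU hφ u.2).2) h0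
    (hv.isClosed_sublevel hY hUY hcont hvU hy₀ hDi hDy 1) ⟨u, hu⟩
  obtain ⟨y, hy, hℓy⟩ := (h4 ℓ).1 hℓc
  refine ⟨y, hy, fun u' hu' => ?_⟩
  have := hℓ ⟨u', hu'⟩
  rw [map_sub, hℓy, hℓy] at this
  exact this

end ValueFunction

/-! ### Dual certificates: necessity and sufficiency. -/

section Optimality

variable {Ω : Type*} [mΩ : MeasurableSpace Ω] {P : Measure Ω} {T d : ℕ}
  {ℱ : Filtration (Fin (T + 1)) mΩ} {U Y : Submodule ℝ (Ω →ₘ[P] ℝ)}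
  {s : Fin (T + 1) → Ω → EuclideanSpace ℝ (Fin d)} {V : ℝ → Ω → EReal} {v : ℝ → Ω → ℝ}

/-- The strategy that holds `c` units of asset `k` over the period starting at `t` on the
event `A`. -/
noncomputable def elementaryStrategy (d : ℕ) (t : Fin T) (A : Set Ω) (k : Fin d) (c : ℝ) :
    Fin (T + 1) → Ω → EuclideanSpace ℝ (Fin d) :=
  fun τ => if τ = t.castSucc then A.indicator fun _ => EuclideanSpace.single k c else 0

theorem elementaryStrategy_mem [IsProbabilityMeasure P] {t : Fin T} {A : Set Ω}
    (hA : MeasurableSet[ℱ t.castSucc] A) (k : Fin d) (c : ℝ) :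
    elementaryStrategy d t A k c ∈ boundedStrategies P ℱ d := by
  refine ⟨fun τ => ?_, |c|, fun τ => ae_of_all _ fun ω => ?_⟩
  · by_cases h : τ = t.castSucc
    · subst h
      simp only [elementaryStrategy, if_true]
      exact Measurable.indicator (@measurable_const _ Ω _ (ℱ t.castSucc) _) hA
    · simp only [elementaryStrategy, h, if_false]
      exact @measurable_const (EuclideanSpace ℝ (Fin d)) Ω _ (ℱ τ) 0
  · by_cases h : τ = t.castSucc
    · by_cases hω : ω ∈ A <;> simp [elementaryStrategy, h, hω]
    · simp [elementaryStrategy, h]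

theorem gains_elementaryStrategy {Ω : Type*} {T d : ℕ}
    {s : Fin (T + 1) → Ω → EuclideanSpace ℝ (Fin d)} (t : Fin T) (A : Set Ω) (k : Fin d) (c : ℝ) (ω : Ω) :
    gains s (elementaryStrategy d t A k c) ω =
      c * A.indicator (fun ω => (s t.succ ω - s t.castSucc ω) k) ω := by
  rw [gains, Finset.sum_eq_single t]
  · by_cases hω : ω ∈ A
    · simp [elementaryStrategy, hω, EuclideanSpace.inner_single_left]
    · simp [elementaryStrategy, hω]
  · intro t' _ ht'
    simp [elementaryStrategy, ht']
  · simp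

/-- A dual variable that bounds the perturbed problem from below has an integrable conjugate
and is a scaled martingale density. -/
theorem conj_le_and_mem_scaledMartingaleDensities [IsProbabilityMeasure P]
    (hv : IsRealDisutility v) (hVv : ∀ᵐ ω ∂P, ∀ ξ, V ξ ω = v ξ ω)
    (hs : ∀ t, Measurable[ℱ t] (s t)) (hvU : ∀ u ∈ U, Integrable (fun ω => v (u ω) ω) P)
    (hφ : ∀ u ∈ U, valueFunction P ℱ s V u ≠ ⊥) (hU : Decomposable U)
    (hx : ∀ x ∈ boundedStrategies P ℱ d, ∃ u ∈ U, objective P s V x u < ⊤)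
    {y : Ω →ₘ[P] ℝ} (hyY : y ∈ Y) (hy : ∀ u ∈ U, Integrable (fun ω => u ω * y ω) P) {K : ℝ}
    (hK : ∀ u ∈ U, ∀ x ∈ strategies ℱ d, Integrable (fun ω => v (u ω - gains s x ω) ω) P →
      pairing u y - ∫ ω, v (u ω - gains s x ω) ω ∂P ≤ K) :
    (∃ D : Ω → ℝ, Integrable D P ∧ (∀ᵐ ω ∂P, ∀ ξ, ξ * y ω - v ξ ω ≤ D ω) ∧ ∫ ω, D ω ∂P ≤ K) ∧
      y ∈ scaledMartingaleDensities ℱ s Y := by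
  have hz : (0 : Ω →ₘ[P] ℝ) =ᵐ[P] fun _ => 0 := AEEqFun.coeFn_zero
  have hbase : ∀ ξ : Ω → ℝ, Measurable ξ → (∃ C : ℝ, ∀ ω, |ξ ω| ≤ C) →
      Integrable (fun ω => max (ξ ω * y ω - v (ξ ω) ω) 0) P ∧
        ∫ ω, max (ξ ω * y ω - v (ξ ω) ω) 0 ∂P ≤ K := by
    rintro ξ hξ ⟨C, hC⟩
    have hK0 : ∀ u ∈ U, Integrable (fun ω => v (u ω - (fun _ => (0 : ℝ)) ω) ω) P →
        pairing u y - ∫ ω, v (u ω - (fun _ => (0 : ℝ)) ω) ω ∂P ≤ K := fun u hu hi => by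
      have := hK u hu 0 zero_mem_strategies
      simp only [gains_zero] at this
      exact this hi
    -- With zero gains and base point `u = 0`, the second entry of the maximum is zero.
    obtain ⟨h1, h2⟩ := hv.integral_max_le hU hy hvU measurable_const hK0 U.zero_mem
      (by simpa using hvU 0 U.zero_mem) hξ hC
    have hae : ∀ᵐ ω ∂P, max (ξ ω * y ω - v (ξ ω) ω + (fun _ => (0 : ℝ)) ω * y ω)
        ((0 : Ω →ₘ[P] ℝ) ω * y ω - v ((0 : Ω →ₘ[P] ℝ) ω - (fun _ => (0 : ℝ)) ω) ω) =
        max (ξ ω * y ω - v (ξ ω) ω) 0 := by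
      filter_upwards [hz] with ω h
      simp [h, hv.map_zero]
    exact ⟨h1.congr hae, integral_congr_ae hae ▸ h2⟩
  have hK0 : 0 ≤ K := (integral_nonneg fun ω => le_max_right _ _).trans
    (hbase (fun _ => 0) measurable_const ⟨0, by simp⟩).2
  have hconj := hv.lintegral_conjENN_le y.measurable hbase
  obtain ⟨hDi, hDy, hDint⟩ :=
    hv.exists_integrable_conj y.measurable (ne_top_of_le_ne_top ENNReal.ofReal_ne_top hconj)
  refine ⟨⟨_, hDi, hDy, ?_⟩, mem_scaledMartingaleDensities hs hyY ?_ ?_ ?_⟩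
  · rw [hDint]
    exact ENNReal.toReal_le_of_le_ofReal hK0 hconj
  -- Since `v ≤ 0` on the negative axis, a negative `y ω` would make `-n * y ω - v (-n) ω` unbounded
  -- in `n`.
  · filter_upwards [hDy] with ω h
    by_contra! hneg
    obtain ⟨n, hn⟩ := exists_nat_gt ((conjENN v y ω).toReal / -y ω)
    rw [div_lt_iff₀ (neg_pos.2 hneg)] at hn
    have h1 := h (-(n : ℝ))
    have h2 : v (-(n : ℝ)) ω ≤ 0 := by
      rw [← hv.map_zero ω]
      exact hv.monotone ω (neg_nonpos.2 n.cast_nonneg)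
    linarith
  · obtain ⟨w, hw, hw1⟩ := hU.exists_bounded (measurable_const (a := (1 : ℝ))) (C := 1) (by simp)
    refine (hy w hw).congr ?_
    filter_upwards [hw1] with ω h
    rw [h, one_mul]
  · intro t A k hA
    set G : Ω → ℝ := A.indicator fun ω => (s t.succ ω - s t.castSucc ω) k with hG
    have key : ∀ c : ℝ, ∃ m : Ω → ℝ, Integrable m P ∧ (∀ ω, c * (G ω * y ω) ≤ m ω) ∧
        ∫ ω, m ω ∂P ≤ K := by
      intro c
      have hmem := elementaryStrategy_mem (P := P) hA k c
      obtain ⟨u, hu, hlt⟩ := hx _ hmem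
      have hi := integrable_of_objective_lt_top hv hVv hs hmem.1 (hφ u hu) hlt
      -- With `ξ = 0`, the first entry of the maximum is exactly `c * (G * y)`.
      obtain ⟨h1, h2⟩ := hv.integral_max_le hU hy hvU (measurable_gains hs hmem.1)
        (fun u hu => hK u hu _ hmem.1) hu hi (measurable_const (a := (0 : ℝ))) (C := 0) (by simp)
      refine ⟨_, h1, fun ω => le_max_of_le_left (le_of_eq ?_), h2⟩
      rw [gains_elementaryStrategy, hv.map_zero]
      ring
    have hGm : Measurable G := by
      refine Measurable.indicator ?_ (ℱ.le _ _ hA)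
      exact (EuclideanSpace.proj (𝕜 := ℝ) k).continuous.measurable.comp
        (((hs t.succ).mono (ℱ.le _) le_rfl).sub ((hs t.castSucc).mono (ℱ.le _) le_rfl))
    have hint : Integrable (fun ω => G ω * y ω) P := by
      -- The multiples `1` and `-1` bound `G * y` from both sides by integrable functions.
      obtain ⟨m₁, h1, h1', -⟩ := key 1
      obtain ⟨m₂, h2, h2', -⟩ := key (-1)
      refine (h1.abs.add h2.abs).mono' (hGm.mul y.measurable).aestronglyMeasurable
        (ae_of_all _ fun ω => ?_)
      have := h1' ω
      have := h2' ω
      rw [Real.norm_eq_abs, Pi.add_apply]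
      refine abs_le.2 ⟨?_, ?_⟩ <;>
        linarith [le_abs_self (m₁ ω), le_abs_self (m₂ ω), abs_nonneg (m₁ ω), abs_nonneg (m₂ ω)]
    have hle : ∀ c : ℝ, c * ∫ ω, G ω * y ω ∂P ≤ K := fun c => by
      obtain ⟨m, hm, hm', hmK⟩ := key c
      rw [← integral_const_mul]
      exact (integral_mono (hint.const_mul c) hm hm').trans hmK
    refine ⟨hint, ?_⟩
    by_contra hne
    -- A nonzero mean would give `K + 1 ≤ K`.
    have := hle ((K + 1) / ∫ ω, G ω * y ω ∂P)
    rw [div_mul_cancel₀ _ hne] at this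
    linarith

/-- An optimal strategy has a scaled martingale density as dual certificate. -/
theorem exists_density_of_optimal [IsProbabilityMeasure P]
    (hv : IsRealDisutility v) (hVv : ∀ᵐ ω ∂P, ∀ ξ, V ξ ω = v ξ ω)
    (hs : ∀ t, Measurable[ℱ t] (s t)) (hvU : ∀ u ∈ U, Integrable (fun ω => v (u ω) ω) P)
    (hφ : ∀ u ∈ U, valueFunction P ℱ s V u ≠ ⊥) (hU : Decomposable U) (hY : Decomposable Y)
    (hUY : ∀ u ∈ U, ∀ y ∈ Y, Integrable (fun ω => u ω * y ω) P) (hbar : Barreled U Y)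
    (hx : ∀ x ∈ boundedStrategies P ℱ d, ∃ u ∈ U, objective P s V x u < ⊤)
    {y₀ : Ω →ₘ[P] ℝ} (hy₀ : y₀ ∈ Y) (hD : ∫⁻ ω, conjENN v y₀ ω ∂P ≠ ⊤)
    {u : Ω →ₘ[P] ℝ} (hu : u ∈ U) {x : Fin (T + 1) → Ω → EuclideanSpace ℝ (Fin d)}
    (hxs : x ∈ strategies ℱ d)
    (hopt : ∀ x' ∈ strategies ℱ d, objective P s V x u ≤ objective P s V x' u) :
    objective P s V x u < ⊤ ∧ ∃ y ∈ scaledMartingaleDensities ℱ s Y,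
      ∀ᵐ ω ∂P, y ω ∈ subdiff V (netPosition s x u ω) ω := by
  have hφx : valueFunction P ℱ s V u = objective P s V x u :=
    le_antisymm (valueFunction_le hxs _) (le_iInf₂ hopt)
  have hφu := coe_toReal_valueFunction hVv hvU hφ hu
  have hlt : objective P s V x u < ⊤ := by
    rw [← hφx, ← hφu.1]
    exact EReal.coe_lt_top _
  refine ⟨hlt, ?_⟩
  have hvx := integrable_of_objective_lt_top hv hVv hs hxs (hφ u hu) hlt
  have hφval : (valueFunction P ℱ s V u).toReal = ∫ ω, v (u ω - gains s x ω) ω ∂P := by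
    rw [hφx, objective_eq_integral hVv hvx, EReal.toReal_coe]
  obtain ⟨y, hyY, hsub⟩ :=
    exists_subgradient_valueFunction hv hVv hs hvU hφ hY hUY hbar hy₀ hD hu
  obtain ⟨⟨D, hDi, hDy, hDK⟩, hyQ⟩ := conj_le_and_mem_scaledMartingaleDensities
    (K := pairing u y - ∫ ω, v (u ω - gains s x ω) ω ∂P) hv hVv hs hvU hφ hU hx hyY
    (fun u hu => hUY u hu y hyY) (fun u' hu' x' hx' hi => by
      have h1 := hsub u' hu'
      have h2 := valueFunction_le (P := P) (s := s) (V := V) hx' u'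
      rw [← (coe_toReal_valueFunction hVv hvU hφ hu').1, objective_eq_integral hVv hi,
        EReal.coe_le_coe_iff] at h2
      linarith)
  have huy := hUY u hu y hyY
  -- The Fenchel inequality at `u - gains` bounds `-gains * y` by the integrable `v(u - gains) + D -
  -- u y`.
  have hneg : Integrable (fun ω => max (-(gains s x ω * y ω)) 0) P := by
    refine ((hvx.add hDi).sub huy).abs.mono'
      (((measurable_gains hs hxs).mul y.measurable).neg.max measurable_const).aestronglyMeasurable ?_
    filter_upwards [hDy] with ω h
    have := h (u ω - gains s x ω)
    rw [Real.norm_of_nonneg (le_max_right _ _)]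
    refine max_le (le_trans ?_ (le_abs_self _)) (abs_nonneg _)
    simp only [Pi.add_apply, Pi.sub_apply]
    linarith
  obtain ⟨hgi, hg0⟩ := integral_gains_mul_eq_zero hs hxs hyQ hneg
  have hi₁ : Integrable (fun ω => v (u ω - gains s x ω) ω + D ω) P := hvx.add hDi
  have hi₂ : Integrable (fun ω => u ω * y ω - gains s x ω * y ω) P := huy.sub hgi
  have hr0 : ∀ᵐ ω ∂P, 0 ≤ v (u ω - gains s x ω) ω + D ω -
      (u ω * y ω - gains s x ω * y ω) := by
    filter_upwards [hDy] with ω h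
    have := h (u ω - gains s x ω)
    linarith
  -- The Fenchel gap has mean at most zero, by `∫ D ≤ K` and the centering of the weighted gains.
  -- Being nonnegative, it vanishes almost surely.
  have hrint : ∫ ω, (v (u ω - gains s x ω) ω + D ω -
      (u ω * y ω - gains s x ω * y ω)) ∂P = 0 := by
    refine le_antisymm ?_ (integral_nonneg_of_ae hr0)
    rw [integral_sub hi₁ hi₂, integral_add hvx hDi, integral_sub huy hgi, hg0]
    change _ - (pairing u y - 0) ≤ 0
    linarith
  have hrz := (integral_eq_zero_iff_of_nonneg_ae hr0 (hi₁.sub hi₂)).1 hrint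
  refine ⟨y, hyQ, ?_⟩
  filter_upwards [hVv, hDy, hrz] with ω h1 h2 h3 ξ
  have h4 := h2 ξ
  rw [h1, h1, ← EReal.coe_add, EReal.coe_le_coe_iff]
  change v (u ω - gains s x ω) ω + (ξ - (u ω - gains s x ω)) * y ω ≤ v ξ ω
  simp only [Pi.zero_apply] at h3
  linarith

/-- A feasible strategy with a scaled martingale density as dual certificate is optimal. -/
theorem optimal_of_density [IsFiniteMeasure P]
    (hv : IsRealDisutility v) (hVv : ∀ᵐ ω ∂P, ∀ ξ, V ξ ω = v ξ ω)
    (hs : ∀ t, Measurable[ℱ t] (s t)) {u : Ω →ₘ[P] ℝ} (hφ : valueFunction P ℱ s V u ≠ ⊥)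
    {x : Fin (T + 1) → Ω → EuclideanSpace ℝ (Fin d)}
    (hxs : x ∈ strategies ℱ d) (hlt : objective P s V x u < ⊤)
    {y : Ω →ₘ[P] ℝ} (hy : y ∈ scaledMartingaleDensities ℱ s Y)
    (hsub : ∀ᵐ ω ∂P, y ω ∈ subdiff V (netPosition s x u ω) ω)
    {x' : Fin (T + 1) → Ω → EuclideanSpace ℝ (Fin d)} (hxs' : x' ∈ strategies ℱ d) :
    objective P s V x u ≤ objective P s V x' u := by
  rcases eq_or_ne (objective P s V x' u) ⊤ with htop | htop
  · rw [htop]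
    exact le_top
  have hi := integrable_of_objective_lt_top hv hVv hs hxs hφ hlt
  have hi' := integrable_of_objective_lt_top hv hVv hs hxs' hφ (lt_top_iff_ne_top.2 htop)
  have hdiff : ∀ ω, gains s ((1 : ℝ) • x' + (-1 : ℝ) • x) ω = gains s x' ω - gains s x ω := by
    intro ω
    rw [gains_add_smul]
    ring
  have hxd := strategies_add_smul hxs' hxs 1 (-1)
  have hle : ∀ᵐ ω ∂P, v (u ω - gains s x ω) ω -
      gains s ((1 : ℝ) • x' + (-1 : ℝ) • x) ω * y ω ≤ v (u ω - gains s x' ω) ω := by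
    filter_upwards [hVv, hsub] with ω h1 h2
    have h3 := h2 (u ω - gains s x' ω)
    rw [h1, h1, ← EReal.coe_add, EReal.coe_le_coe_iff] at h3
    change v (u ω - gains s x ω) ω +
      (u ω - gains s x' ω - (u ω - gains s x ω)) * y ω ≤ _ at h3
    rw [hdiff]
    linarith
  -- Integrability is sought only for the gains of the difference strategy, where the subgradient
  -- inequality supplies an integrable bound on the negative part.
  have hneg : Integrable
      (fun ω => max (-(gains s ((1 : ℝ) • x' + (-1 : ℝ) • x) ω * y ω)) 0) P := by
    refine (hi'.sub hi).abs.mono'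
      (((measurable_gains hs hxd).mul y.measurable).neg.max measurable_const).aestronglyMeasurable ?_
    filter_upwards [hle] with ω h
    rw [Real.norm_of_nonneg (le_max_right _ _)]
    refine max_le (le_trans ?_ (le_abs_self _)) (abs_nonneg _)
    simp only [Pi.sub_apply]
    linarith
  obtain ⟨hgi, hg0⟩ := integral_gains_mul_eq_zero hs hxd hy hneg
  rw [objective_eq_integral hVv hi, objective_eq_integral hVv hi', EReal.coe_le_coe_iff]
  have := integral_mono_ae (hi.sub hgi) hi' hle
  rwa [integral_sub' hi hgi, hg0, sub_zero] at this

end Optimality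

end OptInv

theorem mainTheorem6 {Ω : Type*} [mΩ : MeasurableSpace Ω] (P : Measure Ω) [IsProbabilityMeasure P]
    [P.IsComplete] (T d : ℕ) (ℱ : Filtration (Fin (T + 1)) mΩ)
    (hℱ : ∀ t, (P.trim (ℱ.le t)).IsComplete)
    (U Y : Submodule ℝ (Ω →ₘ[P] ℝ))
    (hU : OptInv.Decomposable U) (hY : OptInv.Decomposable Y)
    (hUY : OptInv.SeparatingDuality U Y)
    (s : Fin (T + 1) → Ω → EuclideanSpace ℝ (Fin d)) (hs : ∀ t, Measurable[ℱ t] (s t))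
    (V : ℝ → Ω → EReal) (hV : OptInv.IsDisutility V)
    (hx : ∀ x ∈ OptInv.boundedStrategies P ℱ d, ∃ u ∈ U, OptInv.objective P s V x u < ⊤)
    (hφ : OptInv.ProperOn (U : Set (Ω →ₘ[P] ℝ)) fun u => OptInv.valueFunction P ℱ s V u)
    (hbar : OptInv.Barreled U Y)
    (hEV : ∀ u ∈ U, OptInv.expect P (fun ω => V (u ω) ω) ≠ ⊥ ∧
      OptInv.expect P (fun ω => V (u ω) ω) ≠ ⊤)
    (hEVconj : OptInv.ProperOn (Y : Set (Ω →ₘ[P] ℝ))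
      fun y => OptInv.expect P fun ω => OptInv.conj V (y ω) ω) :
    ∀ u ∈ U, ∀ x ∈ OptInv.strategies ℱ d,
      (∀ x' ∈ OptInv.strategies ℱ d, OptInv.objective P s V x u ≤ OptInv.objective P s V x' u) ↔
        OptInv.objective P s V x u < ⊤ ∧
          ∃ y ∈ OptInv.scaledMartingaleDensities ℱ s Y,
            ∀ᵐ ω ∂P, y ω ∈ OptInv.subdiff V (OptInv.netPosition s x u ω) ω := by
  -- Decomposability puts the constants in `U`, so finiteness of `EV` there makes `V n` finite
  -- almost surely.
  have hVn : ∀ n : ℕ, ∀ᵐ ω ∂P, V n ω ≠ ⊤ := by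
    intro n
    obtain ⟨w, hw, hwn⟩ := hU.exists_bounded (measurable_const (a := (n : ℝ))) (fun _ => le_rfl)
    have hfin := OptInv.lintegral_ne_top_of_expect_ne_top (hEV w hw).2
    have hae : (fun ω => (V (w ω) ω).toENNReal) =ᵐ[P] fun ω => (V n ω).toENNReal :=
      hwn.mono fun ω h => by simp only [h]
    rw [lintegral_congr_ae hae] at hfin
    have hm : Measurable fun ω => (V n ω).toENNReal :=
      (hV.measurable.comp measurable_prodMk_left).ereal_toENNReal
    filter_upwards [ae_lt_top hm hfin] with ω h htop
    simp [htop] at h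
  obtain ⟨v, hv, hVv⟩ := hV.exists_real hVn
  have hvU : ∀ u ∈ U, Integrable (fun ω => v (u ω) ω) P := by
    intro u hu
    have heq := OptInv.expect_congr_ae (hVv.mono fun ω h => h (u ω))
    refine OptInv.integrable_of_expect_ne (hv.measurable_comp u.measurable).aestronglyMeasurable
      (heq ▸ (hEV u hu).2) (heq ▸ (hEV u hu).1)
  obtain ⟨-, y₀, hy₀, hconj⟩ := hEVconj
  intro u hu x hxs
  constructor
  · exact OptInv.exists_density_of_optimal hv hVv hs hvU hφ.1 hU hY hUY.integrable hbar hx hy₀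
      (OptInv.IsRealDisutility.lintegral_conjENN_ne_top hVv hconj) hu hxs
  · rintro ⟨hlt, y, hy, hsub⟩ x' hx'
    exact OptInv.optimal_of_density hv hVv hs (hφ.1 u hu) hxs hlt hy hsub hx'
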